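/- Let $D>0$ and $\gamma>0$, and let $\vartheta=(\vartheta_t)_{t\ge 0}$ be a centered real Gaussian process on a probability space $(\Omega,\mathcal A,P)$ with covariance $$E\,\vartheta_s\vartheta_t=2D\,(s\wedge t)^{1+\gamma}(s\vee t),\qquad s,t\ge 0.$$ Then: (i) $\vartheta$ is a Markov process (with respect to its own past): for $s\le t$ and every Borel set $A$, $P(\vartheta_t\in A\mid \vartheta_r,\ r\le s)=P(\vartheta_t\in A\mid\vartheta_s)$ a.s. (ii) $\vartheta$ is self-similar with index $(2+\gamma)/2$: for every $a>0$ the processes $(\vartheta_{at})_{t\ge 0}$ and $(a^{(2+\gamma)/2}\vartheta_t)_{t\ge 0}$ have the same law (finite-dimensional distributions). Moreover, there are on $(\Omega,\mathcal A,P)$ a filtration $(\mathcal F_t)_{t\ge0}$ and a standard Brownian motion $\beta$ with respect to $(\mathcal F_t)$ (with almost surely continuous paths) such that the following hold. (iii) For every $t\ge 0$, almost surely, $$\vartheta_t=\sqrt{2D\gamma}\;t\int_0^t u^{(\gamma-1)/2}\,d\beta_u ,$$ where the integral is the Wiener integral (the $L^2(P)$-limit of the elementary integrals of step functions converging to the integrand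 in $L^2(0,t)$). (iv) $\vartheta$ has an $(\mathcal F_t)$-adapted modification with almost surely continuous paths, again denoted by $\vartheta$, which solves the stochastic differential equation $$d\vartheta_t=\frac1t\,\vartheta_t\,dt+\sqrt{2D\gamma}\;t^{(\gamma+1)/2}\,d\beta_t ,$$ that is, almost surely, for all $t\ge0$: $u\mapsto\vartheta_u/u$ is Lebesgue integrable on $(0,t)$ and $$\vartheta_t=\vartheta_0+\int_0^t\frac{\vartheta_u}{u}\,du+\sqrt{2D\gamma}\int_0^t u^{(\gamma+1)/2}\,d\beta_u,$$ where the last term is a version of the Wiener integral process. -/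

import Mathlib

open MeasureTheory ProbabilityTheory Filter Topology
open scoped NNReal ENNReal

noncomputable section

/-- The `σ`-algebra `σ(X_r : r ≤ s)` generated by the process `X` up to time `s`. -/
abbrev pastSigma {Ω : Type*} (X : ℝ≥0 → Ω → ℝ) (s : ℝ≥0) : MeasurableSpace Ω :=
  ⨆ r : Set.Iic s, MeasurableSpace.comap (X r) inferInstance

/-- `X` is a Markov process (with respect to its own past): for `s ≤ t` and every Borel set `A`,
`P(X_t ∈ A | X_r, r ≤ s) = P(X_t ∈ A | X_s)` almost surely. -/
structure IsMarkovProcess {Ω : Type*} {mΩ : MeasurableSpace Ω}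
    (X : ℝ≥0 → Ω → ℝ) (P : Measure Ω) : Prop where
  measurable : ∀ t, Measurable (X t)
  markov : ∀ s t : ℝ≥0, s ≤ t → ∀ A : Set ℝ, MeasurableSet A →
    P⟦X t ⁻¹' A | pastSigma X s⟧ =ᵐ[P]
      P⟦X t ⁻¹' A | MeasurableSpace.comap (X s) inferInstance⟧

/-- `X` is self-similar with index `H`: for every `a > 0` the processes `(X_{at})_{t ≥ 0}` and
`(a ^ H X_t)_{t ≥ 0}` have the same law (on `ℝ≥0 → ℝ` with the product `σ`-algebra, that is,
the same finite-dimensional distributions). -/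
def IsSelfSimilar {Ω : Type*} {mΩ : MeasurableSpace Ω}
    (X : ℝ≥0 → Ω → ℝ) (H : ℝ) (P : Measure Ω) : Prop :=
  ∀ a : ℝ≥0, 0 < a →
    IdentDistrib (fun ω (t : ℝ≥0) => X (a * t) ω) (fun ω (t : ℝ≥0) => (a : ℝ) ^ H * X t ω) P P

/-- A step function on `(0, T]`: a finite linear combination `∑ cᵢ 1_{(aᵢ, bᵢ]}` of indicators of
intervals `(aᵢ, bᵢ] ⊆ (0, T]`. -/
structure StepFunction (T : ℝ≥0) where
  n : ℕ
  a : Fin n → ℝ≥0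
  b : Fin n → ℝ≥0
  c : Fin n → ℝ
  a_le_b : ∀ i, a i ≤ b i
  b_le : ∀ i, b i ≤ T

/-- The function `∑ cᵢ 1_{(aᵢ, bᵢ]}`. -/
def StepFunction.eval {T : ℝ≥0} (φ : StepFunction T) (u : ℝ) : ℝ :=
  ∑ i, (Set.Ioc (φ.a i : ℝ) (φ.b i : ℝ)).indicator (fun _ => φ.c i) u

/-- The elementary stochastic integral `∑ cᵢ (β_{bᵢ} - β_{aᵢ})`. -/
def StepFunction.integral {T : ℝ≥0} {Ω : Type*} (φ : StepFunction T) (β : ℝ≥0 → Ω → ℝ)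
    (ω : Ω) : ℝ :=
  ∑ i, φ.c i * (β (φ.b i) ω - β (φ.a i) ω)

/-- The random variable `I` is (a version of) the Wiener integral `∫_0^T f(u) dβ_u` of the
deterministic function `f`: there are step functions `φₖ` converging to `f` in `L²(0, T)` whose
elementary integrals converge to `I` in `L²(P)`. (For a Brownian motion `β`, by the Itô isometry,
such an `I` exists exactly when `f ∈ L²(0, T)`, and it is unique up to almost sure equality.) -/
def IsWienerIntegral {Ω : Type*} {mΩ : MeasurableSpace Ω} (β : ℝ≥0 → Ω → ℝ) (P : Measure Ω)
    (f : ℝ → ℝ) (T : ℝ≥0) (I : Ω → ℝ) : Prop :=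
  ∃ φ : ℕ → StepFunction T,
    Tendsto (fun k => eLpNorm (fun u => f u - (φ k).eval u) 2
      (volume.restrict (Set.Ioc (0 : ℝ) T))) atTop (𝓝 0) ∧
    Tendsto (fun k => eLpNorm (fun ω => I ω - (φ k).integral β ω) 2 P) atTop (𝓝 0)

/-- `β` is a standard Brownian motion with respect to the filtration `𝓕`. -/
structure IsFiltrationBrownian {Ω : Type*} {mΩ : MeasurableSpace Ω} (𝓕 : Filtration ℝ≥0 mΩ)
    (β : ℝ≥0 → Ω → ℝ) (P : Measure Ω) : Prop where
  brownian : IsBrownianReal β P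
  adapted : ∀ t, Measurable[𝓕 t] (β t)
  indep : ∀ s t : ℝ≥0, s ≤ t →
    Indep (MeasurableSpace.comap (fun ω => β t ω - β s ω) inferInstance) (𝓕 s) P

/-- `X` is a solution, on the filtered probability space `(Ω, 𝓕, P)`, of the stochastic
differential equation `dX_t = b(t, X_t) dt + σ(t) dβ_t`, `t ≥ 0`, driven by the `𝓕`-Brownian
motion `β`. The diffusion coefficient is deterministic, so the stochastic integral is a Wiener
integral. -/
structure IsSDESolution {Ω : Type*} {mΩ : MeasurableSpace Ω} (𝓕 : Filtration ℝ≥0 mΩ)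
    (β : ℝ≥0 → Ω → ℝ) (P : Measure Ω) (b : ℝ → ℝ → ℝ) (σ : ℝ → ℝ) (X : ℝ≥0 → Ω → ℝ) : Prop where
  brownian : IsFiltrationBrownian 𝓕 β P
  adapted : ∀ t, Measurable[𝓕 t] (X t)
  continuous : ∀ᵐ ω ∂P, Continuous (fun t => X t ω)
  integrable_drift : ∀ᵐ ω ∂P, ∀ t : ℝ≥0,
    IntervalIntegrable (fun u : ℝ => b u (X u.toNNReal ω)) volume 0 t
  equation : ∃ J : ℝ≥0 → Ω → ℝ, (∀ t, IsWienerIntegral β P σ t (J t)) ∧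
    ∀ᵐ ω ∂P, ∀ t : ℝ≥0,
      X t ω = X 0 ω + (∫ u in (0 : ℝ)..t, b u (X u.toNNReal ω)) + J t ω

end

/-! Everything rests on the quotient `Y t = ϑ t / t`. Dividing the covariance by `s * t` leaves `2D
(s ∧ t) ^ γ`, so `Y` is a Brownian motion run at the clock `2D t ^ γ`. In particular `ϑ t - (t / s)
ϑ s` is uncorrelated with the past of `s`, hence independent of it by joint Gaussianity, which is
the Markov property. Self-similarity is the homogeneity of the covariance, of degree `2 + γ`. The
time change also gives a continuous modification of `Y`, once pre-Brownian motions are known to have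
one.

The Brownian motion `β` must live on the given space. With `h u = √(2Dγ) u ^ ((γ - 1) / 2)`, the
vectors `1_{(0, t]} h` of `L²(0, ∞)` have the same Gram matrix as the `Y t` in `L²(P)`, because `h²`
integrates over `(0, t]` to `2D t ^ γ`. Since `h` does not vanish, these vectors span a dense
subspace, so `1_{(0, t]} h ↦ Y t` extends to a linear isometry `J` of `L²(0, ∞)` into `L²(P)`
(`exists_isonormal`). Its values are centered Gaussian, being limits of combinations of the `Y t`. A
continuous version of `J 1_{(0, t]}` is the Brownian motion `β`, and `J` is then Wiener integration
against `β`, which gives (iii).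

For (iv), put `X t = t * Y t`. Integration by parts (`map_truncLp_id_mul_ae_eq`) reads `J (1_{(0,
t]} u h(u)) = t Y_t - ∫_0^t Y_u du`, and `u h(u)` is the diffusion coefficient: this is the
equation. The filtration is generated jointly by `β` and `X`, so that `X` is adapted without any
completion; increments of `β` stay independent of it because `1_{(s, t]}` is orthogonal to
everything supported in `(0, s]`. -/

/-! ### Gaussian laws, and the Markov property from covariances -/

/-- Two Gaussian processes with the same means and covariances have the same law. -/
theorem ProbabilityTheory.IsGaussianProcess.identDistrib_of_covariance_eq {T Ω : Type*}
    {mΩ : MeasurableSpace Ω} {P : Measure Ω} {X Y : T → Ω → ℝ}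
    (hX : IsGaussianProcess X P) (hY : IsGaussianProcess Y P)
    (mX : ∀ t, Measurable (X t)) (mY : ∀ t, Measurable (Y t))
    (hmean : ∀ t, P[X t] = P[Y t]) (hcov : ∀ s t, cov[X s, X t; P] = cov[Y s, Y t; P]) :
    IdentDistrib (fun ω t ↦ X t ω) (fun ω t ↦ Y t ω) P P := by
  have := hX.isProbabilityMeasure
  rw [identDistrib_iff_forall_finset_identDistrib (measurable_pi_lambda _ mX).aemeasurable
    (measurable_pi_lambda _ mY).aemeasurable]
  intro I
  refine ⟨aemeasurable_pi_lambda _ fun _ ↦ hX.aemeasurable _,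
    aemeasurable_pi_lambda _ fun _ ↦ hY.aemeasurable _, ?_⟩
  -- The comparison is carried to Euclidean space, where a Gaussian measure is determined by its
  -- mean and its covariance form.
  apply (MeasurableEquiv.toLp 2 (_ → ℝ)).map_measurableEquiv_injective
  rw [MeasurableEquiv.coe_toLp, ← PiLp.coe_symm_continuousLinearEquiv 2 ℝ]
  have := (hX.hasGaussianLaw I).isGaussian_map
  have := (hY.hasGaussianLaw I).isGaussian_map
  have amX : AEMeasurable (fun ω ↦ I.restrict (X · ω)) P :=
    aemeasurable_pi_lambda _ fun _ ↦ hX.aemeasurable _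
  have amY : AEMeasurable (fun ω ↦ I.restrict (Y · ω)) P :=
    aemeasurable_pi_lambda _ fun _ ↦ hY.aemeasurable _
  apply IsGaussian.ext
  · rw [integral_map (by fun_prop) (by fun_prop), integral_map amX (by fun_prop),
      integral_map (by fun_prop) (by fun_prop), integral_map amY (by fun_prop)]
    simp only [id_eq]
    rw [ContinuousLinearEquiv.integral_comp_comm, ContinuousLinearEquiv.integral_comp_comm]
    congr 1
    ext i
    exact (eval_integral (f := fun ω (i : I) ↦ X i ω)
      (fun _ ↦ (hX.hasGaussianLaw_eval _).integrable) i).trans ((hmean i).trans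
      (eval_integral (f := fun ω (i : I) ↦ Y i ω)
        (fun _ ↦ (hY.hasGaussianLaw_eval _).integrable) i).symm)
  · rw [← ContinuousLinearMap.toBilinForm_inj]
    refine LinearMap.BilinForm.ext_of_isSymm isPosSemidef_covarianceBilin.isSymm
      isPosSemidef_covarianceBilin.isSymm fun x ↦ ?_
    simp only [ContinuousLinearMap.toBilinForm_apply]
    rw [PiLp.coe_symm_continuousLinearEquiv, covarianceBilin_apply_pi, covarianceBilin_apply_pi]
    · congrm ∑ i, ∑ j, _ * ?_
      rw [covariance_map _ _ amX, covariance_map _ _ amY]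
      · exact hcov i j
      all_goals exact Measurable.aestronglyMeasurable (by fun_prop)
    · exact fun i ↦ ((hY.hasGaussianLaw I).isGaussian_map.hasGaussianLaw_id.eval i).memLp_two
    · exact fun i ↦ ((hX.hasGaussianLaw I).isGaussian_map.hasGaussianLaw_id.eval i).memLp_two

/-- If `X` is `m`-measurable and `Z` is independent of `m`, then the conditional probability of
`X + Z ∈ A` given `m` is a measurable function of `X`. -/
theorem condExp_preimage_add_of_indep {Ω : Type*} {m mΩ : MeasurableSpace Ω} {P : Measure Ω}
    [IsProbabilityMeasure P] (hm : m ≤ mΩ) {X Z : Ω → ℝ} (hX : Measurable[m] X)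
    (hZ : Measurable Z) (hind : Indep m (MeasurableSpace.comap Z inferInstance) P)
    {A : Set ℝ} (hA : MeasurableSet A) :
    P⟦(fun ω ↦ X ω + Z ω) ⁻¹' A | m⟧ =ᵐ[P]
      fun ω ↦ ((P.map Z) {z | X ω + z ∈ A}).toReal := by
  have : IsProbabilityMeasure (P.map Z) := Measure.isProbabilityMeasure_map hZ.aemeasurable
  have hX' : Measurable X := hX.mono hm le_rfl
  have hg : Measurable fun x : ℝ ↦ (P.map Z) {z | x + z ∈ A} :=
    measurable_measure_prodMk_left (ν := P.map Z) (s := {p : ℝ × ℝ | p.1 + p.2 ∈ A})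
      (measurableSet_preimage (by fun_prop) hA)
  have hgX : StronglyMeasurable[m] fun ω ↦ ((P.map Z) {z | X ω + z ∈ A}).toReal :=
    (hg.ennreal_toReal.comp hX).stronglyMeasurable
  have hS : MeasurableSet ((fun ω ↦ X ω + Z ω) ⁻¹' A) := (hX'.add hZ) hA
  have hbd : Integrable (fun ω ↦ ((P.map Z) {z | X ω + z ∈ A}).toReal) P := by
    refine Integrable.of_bound (hgX.mono hm).aestronglyMeasurable 1 (ae_of_all _ fun ω ↦ ?_)
    rw [Real.norm_of_nonneg ENNReal.toReal_nonneg]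
    exact measureReal_le_one
  symm
  refine ae_eq_condExp_of_forall_setIntegral_eq hm
    ((integrable_const _).indicator hS) (fun s _ _ ↦ hbd.integrableOn) (fun s hs _ ↦ ?_)
    hgX.aestronglyMeasurable
  have hs' := hm s hs
  rw [integral_indicator hS, integral_const, smul_eq_mul, mul_one, measureReal_restrict_apply_univ,
    measureReal_restrict_apply hS, integral_toReal
      (f := fun ω ↦ (P.map Z) {z | X ω + z ∈ A}) ((hg.comp hX').aemeasurable) (ae_of_all _ fun _ ↦ measure_lt_top _ _), measureReal_def]
  congr 1
  -- Pairing `X` with the indicator of `s` gives an `m`-measurable variable, hence one independent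
  -- of `Z`. The event becomes a set for the product law of `W` and `Z`, and Fubini integrates `Z`
  -- out.
  let W : Ω → ℝ × ℝ := fun ω ↦ (s.indicator 1 ω, X ω)
  have hW : Measurable[m] W :=
    Measurable.prodMk ((measurable_indicator_const_iff (1 : ℝ)).2 hs) hX
  have hW' : Measurable W := hW.mono hm le_rfl
  have hWZ : IndepFun W Z P := by
    rw [IndepFun_iff_Indep]
    exact indep_of_indep_of_le_left hind (measurable_iff_comap_le.1 hW)
  rw [indepFun_iff_map_prod_eq_prod_map_map hW'.aemeasurable hZ.aemeasurable] at hWZ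
  let B : Set ((ℝ × ℝ) × ℝ) := {p | p.1.1 = 1 ∧ p.1.2 + p.2 ∈ A}
  have hB : MeasurableSet B :=
    (measurableSet_eq_fun (by fun_prop) (by fun_prop)).inter
      (measurableSet_preimage (by fun_prop : Measurable fun p : (ℝ × ℝ) × ℝ ↦ p.1.2 + p.2) hA)
  have h1 : P ((fun ω ↦ X ω + Z ω) ⁻¹' A ∩ s) = P.map (fun ω ↦ (W ω, Z ω)) B := by
    rw [Measure.map_apply (hW'.prodMk hZ) hB]
    congr 1
    ext ω
    by_cases h : ω ∈ s <;> simp [W, B, h]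
  rw [h1, hWZ, Measure.prod_apply hB, lintegral_map (measurable_measure_prodMk_left hB) hW',
    ← lintegral_indicator hs']
  congr 1 with ω
  by_cases h : ω ∈ s <;> simp [W, B, h]

/-- A centered Gaussian process `X` is Markov as soon as for `s ≤ t` there is `c` such that
`X t - c * X s` is uncorrelated with the past of `X` up to time `s`. -/
theorem ProbabilityTheory.IsGaussianProcess.isMarkovProcess {Ω : Type*}
    {mΩ : MeasurableSpace Ω} {P : Measure Ω} {X : ℝ≥0 → Ω → ℝ} (hX : IsGaussianProcess X P)
    (mX : ∀ t, Measurable (X t))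
    (hcov : ∀ s t : ℝ≥0, s ≤ t → ∃ c : ℝ, ∀ r ≤ s,
      cov[fun ω ↦ X t ω - c * X s ω, X r; P] = 0) :
    IsMarkovProcess X P where
  measurable := mX
  markov s t hst A hA := by
    have := hX.isProbabilityMeasure
    obtain ⟨c, hc⟩ := hcov s t hst
    let Z : Ω → ℝ := fun ω ↦ X t ω - c * X s ω
    have hZ : Measurable Z := (mX t).sub ((mX s).const_mul c)
    have hind : IndepFun (fun ω (_ : Unit) ↦ Z ω) (fun ω (r : Set.Iic s) ↦ X r ω) P := by
      refine IsGaussianProcess.indepFun_of_covariance_eq_zero (X := fun _ : Unit ↦ Z)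
        (Y := fun r : Set.Iic s ↦ X r) ?_ (fun _ ↦ hZ.aemeasurable)
        (fun r ↦ (mX r).aemeasurable) fun _ r ↦ hc r r.2
      apply hX.of_isGaussianProcess
      rintro (_ | ⟨r, hr⟩)
      · exact ⟨{s, t},
          { toFun x := x ⟨t, by simp⟩ - c * x ⟨s, by simp⟩
            map_add' x y := by simp; ring
            map_smul' a x := by simp; ring }, by simp [Z]⟩
      · exact ⟨{r},
          { toFun x := x ⟨r, by simp⟩
            map_add' x y := by simp
            map_smul' c x := by simp }, by simp⟩
    have hle : pastSigma X s ≤ mΩ := iSup_le fun r ↦ (mX r).comap_le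
    have hsp : MeasurableSpace.comap (X s) inferInstance ≤ pastSigma X s :=
      le_iSup (fun r : Set.Iic s ↦ MeasurableSpace.comap (X r) inferInstance) ⟨s, le_refl s⟩
    have hI : Indep (pastSigma X s) (MeasurableSpace.comap Z inferInstance) P := by
      have h2 := hind.symm
      rw [IndepFun_iff_Indep] at h2
      refine indep_of_indep_of_le_left (indep_of_indep_of_le_right h2 ?_) ?_
      · exact measurable_iff_comap_le.1 <|
          (measurable_pi_apply ()).comp (comap_measurable fun ω (_ : Unit) ↦ Z ω)
      · exact iSup_le fun r ↦ measurable_iff_comap_le.1 <|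
          (measurable_pi_apply r).comp (comap_measurable fun ω (r : Set.Iic s) ↦ X r ω)
    have hXt : X t = fun ω ↦ c * X s ω + Z ω := by ext; simp [Z]
    have hmes : Measurable[MeasurableSpace.comap (X s) inferInstance] fun ω ↦ c * X s ω :=
      (comap_measurable (X s)).const_mul c
    rw [hXt]
    -- Conditioning on the whole past and on `X s` alone gives the same function of `X s`.
    exact (condExp_preimage_add_of_indep hle (hmes.mono hsp le_rfl) hZ hI hA).trans
      (condExp_preimage_add_of_indep (mX s).comap_le hmes hZ
        (indep_of_indep_of_le_left hI hsp) hA).symm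

/-! ### Continuous modifications by dyadic chaining -/

/-- The largest multiple of `2⁻ⁿ` below `t`. -/
noncomputable def dyadicFloor (n : ℕ) (t : ℝ≥0) : ℝ≥0 := (⌊(2 : ℝ≥0) ^ n * t⌋₊ : ℝ≥0) / 2 ^ n

lemma floor_two_pow_mul_lt {N : ℕ} {t : ℝ≥0} (ht : t < N) (n : ℕ) :
    ⌊(2 : ℝ≥0) ^ n * t⌋₊ < N * 2 ^ n := by
  rw [Nat.floor_lt (by positivity)]
  push_cast
  rw [mul_comm]
  gcongr

lemma tendsto_dyadicFloor (t : ℝ≥0) : Tendsto (fun n ↦ dyadicFloor n t) atTop (𝓝 t) := by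
  rw [tendsto_iff_dist_tendsto_zero]
  refine squeeze_zero (fun _ ↦ dist_nonneg) (fun n ↦ ?_)
    (tendsto_pow_atTop_nhds_zero_of_lt_one (r := (1 / 2 : ℝ)) (by norm_num) (by norm_num))
  have h1 : ((⌊(2 : ℝ≥0) ^ n * t⌋₊ : ℝ≥0) : ℝ) ≤ (2 : ℝ) ^ n * t := by
    exact_mod_cast Nat.floor_le (R := ℝ≥0) (by positivity)
  have h2 : (2 : ℝ) ^ n * t < ((⌊(2 : ℝ≥0) ^ n * t⌋₊ : ℝ≥0) : ℝ) + 1 := by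
    exact_mod_cast Nat.lt_floor_add_one ((2 : ℝ≥0) ^ n * t)
  rw [NNReal.dist_eq, dyadicFloor, NNReal.coe_div, NNReal.coe_pow, NNReal.coe_ofNat, abs_le,
    one_div, inv_pow]
  have h3 : (0 : ℝ) < 2 ^ n := by positivity
  constructor
  · rw [neg_le_sub_iff_le_add, ← sub_le_iff_le_add, ← sub_nonneg]
    field_simp
    linarith
  · rw [sub_le_iff_le_add]
    field_simp
    linarith

/-- A path whose increments between adjacent dyadic points of level `n` are, on each bounded
interval, at most the `n`-th term of a summable series coincides on the dyadic points in the limit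
with a continuous function. -/
theorem exists_continuous_tendsto_dyadicFloor {x : ℝ≥0 → ℝ}
    (hx : ∀ N : ℕ, ∃ b : ℕ → ℝ, Summable b ∧ ∀ n k : ℕ, k < N * 2 ^ n →
      |x ((k + 1 : ℕ) / 2 ^ n) - x (k / 2 ^ n)| ≤ b n) :
    ∃ y : ℝ≥0 → ℝ, Continuous y ∧
      ∀ t, Tendsto (fun n ↦ x (dyadicFloor n t)) atTop (𝓝 (y t)) := by
  choose b hb hxb using hx
  have hstep : ∀ (N : ℕ) (t : ℝ≥0), t < N → ∀ n,
      dist (x (dyadicFloor n t)) (x (dyadicFloor (n + 1) t)) ≤ b N (n + 1) := by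
    intro N t ht n
    have hk := floor_two_pow_mul_lt ht n
    have hk' := floor_two_pow_mul_lt ht (n + 1)
    unfold dyadicFloor
    set k := ⌊(2 : ℝ≥0) ^ n * t⌋₊ with hkdef
    set j := ⌊(2 : ℝ≥0) ^ (n + 1) * t⌋₊ with hjdef
    -- Halving `j` recovers `k`, so consecutive dyadic approximations of `t` coincide or are
    -- neighbours at the finer level.
    have hkj : k = j / 2 := by
      rw [hkdef, hjdef, ← Nat.floor_div_ofNat, pow_succ]
      congr 1
      field_simp
    have hkeq : (k : ℝ≥0) / 2 ^ n = ((2 * k : ℕ) : ℝ≥0) / 2 ^ (n + 1) := by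
      rw [pow_succ]; push_cast; field_simp
    rw [hkeq, dist_comm, Real.dist_eq]
    have h2k : 2 * k < N * 2 ^ (n + 1) := by rw [pow_succ, ← mul_assoc]; omega
    obtain h | h : j = 2 * k ∨ j = 2 * k + 1 := by omega
    · rw [h, sub_self, abs_zero]
      exact (abs_nonneg _).trans (hxb N (n + 1) _ h2k)
    · rw [h]
      exact hxb N (n + 1) _ h2k
  have hsum : ∀ N, Summable fun n ↦ b N (n + 1) := fun N ↦ (summable_nat_add_iff 1).2 (hb N)
  have hlim : ∀ t, ∃ l, Tendsto (fun n ↦ x (dyadicFloor n t)) atTop (𝓝 l) := by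
    intro t
    obtain ⟨N, hN⟩ := exists_nat_gt t
    exact cauchySeq_tendsto_of_complete
      (cauchySeq_of_dist_le_of_summable _ (hstep N t hN) (hsum N))
  choose y hy using hlim
  refine ⟨y, ?_, hy⟩
  have hdist : ∀ (N : ℕ) (t : ℝ≥0), t < N → ∀ n,
      dist (x (dyadicFloor n t)) (y t) ≤ ∑' m, b N (n + m + 1) := fun N t ht n ↦
    dist_le_tsum_of_dist_le_of_tendsto _ (hstep N t ht) (hsum N) (hy t) n
  rw [continuous_iff_continuousAt]
  intro t
  obtain ⟨N, hN⟩ := exists_nat_gt t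
  rw [ContinuousAt, Metric.tendsto_nhds]
  intro ε hε
  have htail : Tendsto (fun n ↦ (∑' m, b N (n + m + 1)) + b N n + ∑' m, b N (n + m + 1))
      atTop (𝓝 0) := by
    have h1 : Tendsto (fun n ↦ ∑' m, b N (n + m + 1)) atTop (𝓝 0) := by
      have := tendsto_sum_nat_add fun n ↦ b N (n + 1)
      simpa only [add_comm, add_left_comm, add_assoc] using this
    simpa using (h1.add (hb N).tendsto_atTop_zero).add h1
  obtain ⟨n, hn⟩ := (htail.eventually (gt_mem_nhds hε)).exists
  have hnear : ∀ᶠ s in 𝓝 t, dist s t < (2 ^ n)⁻¹ := Metric.ball_mem_nhds t (by positivity)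
  filter_upwards [hnear, gt_mem_nhds hN] with s hs hsN
  -- Points closer than `2⁻ⁿ` have floors at level `n` that differ by at most one.
  have hmid : dist (x (dyadicFloor n s)) (x (dyadicFloor n t)) ≤ b N n := by
    have hj := floor_two_pow_mul_lt hsN n
    have hk := floor_two_pow_mul_lt hN n
    have hs1 : ((⌊(2 : ℝ≥0) ^ n * s⌋₊ : ℝ≥0) : ℝ) ≤ (2 : ℝ) ^ n * s := by
      exact_mod_cast Nat.floor_le (R := ℝ≥0) (by positivity)
    have hs2 : (2 : ℝ) ^ n * s < ((⌊(2 : ℝ≥0) ^ n * s⌋₊ : ℝ≥0) : ℝ) + 1 := by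
      exact_mod_cast Nat.lt_floor_add_one ((2 : ℝ≥0) ^ n * s)
    have ht1 : ((⌊(2 : ℝ≥0) ^ n * t⌋₊ : ℝ≥0) : ℝ) ≤ (2 : ℝ) ^ n * t := by
      exact_mod_cast Nat.floor_le (R := ℝ≥0) (by positivity)
    have ht2 : (2 : ℝ) ^ n * t < ((⌊(2 : ℝ≥0) ^ n * t⌋₊ : ℝ≥0) : ℝ) + 1 := by
      exact_mod_cast Nat.lt_floor_add_one ((2 : ℝ≥0) ^ n * t)
    unfold dyadicFloor
    set j := ⌊(2 : ℝ≥0) ^ n * s⌋₊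
    set k := ⌊(2 : ℝ≥0) ^ n * t⌋₊
    rw [NNReal.dist_eq, abs_lt, lt_sub_iff_add_lt, sub_lt_iff_lt_add] at hs
    have h0 : (0 : ℝ) < 2 ^ n := by positivity
    have hst1 : (2 : ℝ) ^ n * s < 1 + 2 ^ n * t := by
      calc (2 : ℝ) ^ n * s < 2 ^ n * ((2 ^ n)⁻¹ + t) := by gcongr; exact hs.2
        _ = 1 + 2 ^ n * t := by field_simp
    have hst2 : (2 : ℝ) ^ n * t < 1 + 2 ^ n * s := by
      calc (2 : ℝ) ^ n * t < 2 ^ n * ((2 ^ n)⁻¹ + s) := by gcongr; linarith [hs.1]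
        _ = 1 + 2 ^ n * s := by field_simp
    have hjk1 : j < k + 2 := by
      have : (j : ℝ) < k + 2 := by push_cast at *; linarith
      exact_mod_cast this
    have hjk2 : k < j + 2 := by
      have : (k : ℝ) < j + 2 := by push_cast at *; linarith
      exact_mod_cast this
    obtain h | h | h : j = k ∨ j = k + 1 ∨ k = j + 1 := by omega
    · rw [h, dist_self]
      exact (abs_nonneg _).trans (hxb N n _ hk)
    · rw [h]
      exact hxb N n _ hk
    · rw [h, dist_comm]
      exact hxb N n _ hj
  calc dist (y s) (y t) ≤ dist (y s) (x (dyadicFloor n s))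
        + dist (x (dyadicFloor n s)) (x (dyadicFloor n t)) + dist (x (dyadicFloor n t)) (y t) :=
        dist_triangle4 _ _ _ _
    _ ≤ (∑' m, b N (n + m + 1)) + b N n + ∑' m, b N (n + m + 1) := by
        rw [dist_comm (y s)]
        exact add_le_add (add_le_add (hdist N s hsN n) hmid) (hdist N t hN n)
    _ < ε := hn

namespace ProbabilityTheory.IsPreBrownianReal

variable {Ω : Type*} {mΩ : MeasurableSpace Ω} {P : Measure Ω} {B : ℝ≥0 → Ω → ℝ}

/-- The fourth moments of the increments of a pre-Brownian motion. -/
lemma exists_lintegral_sub_pow_four (hB : IsPreBrownianReal B P) :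
    ∃ c : ℝ, 0 ≤ c ∧ ∀ s t, ∫⁻ ω, ENNReal.ofReal ((B s ω - B t ω) ^ 4) ∂P =
      ENNReal.ofReal (c * dist s t ^ 2) := by
  have hint : Integrable (fun x : ℝ ↦ x ^ 4) (gaussianReal 0 1) := by
    have := (memLp_id_gaussianReal (μ := 0) (v := 1) 4).integrable_norm_pow (by norm_num)
    simpa [Even.pow_abs (show Even 4 by decide)] using this
  refine ⟨∫ x, x ^ 4 ∂gaussianReal 0 1, integral_nonneg fun x ↦ by positivity, fun s t ↦ ?_⟩
  have hlaw : HasLaw (B s - B t) (gaussianReal 0 (nndist s.1 t.1)) P := hB.hasLaw_sub s t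
  -- Scaling a standard Gaussian by the square root of `dist s t` turns its fourth moment into a
  -- multiple of `dist s t ^ 2`.
  have hmap : gaussianReal 0 (nndist s.1 t.1) =
      (gaussianReal 0 1).map (√(dist s t) * ·) := by
    rw [gaussianReal_map_const_mul]
    congr 1
    · simp
    · ext
      simp [NNReal.dist_eq, Real.dist_eq]
  have h1 : ∫⁻ ω, ENNReal.ofReal ((B s ω - B t ω) ^ 4) ∂P =
      ∫⁻ x, ENNReal.ofReal (x ^ 4) ∂(P.map (B s - B t)) :=
    (lintegral_map' (f := fun x : ℝ ↦ ENNReal.ofReal (x ^ 4)) (by fun_prop)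
      hlaw.aemeasurable).symm
  rw [h1, hlaw.map_eq, hmap, lintegral_map (by fun_prop) (by fun_prop), mul_comm,
    ENNReal.ofReal_mul (by positivity), ofReal_integral_eq_lintegral_ofReal hint
    (ae_of_all _ fun x ↦ by positivity), ← lintegral_const_mul _ (by fun_prop)]
  congr 1 with x
  rw [← ENNReal.ofReal_mul (by positivity), mul_pow]
  congr 2
  rw [show (4 : ℕ) = 2 * 2 from rfl, pow_mul, Real.sq_sqrt dist_nonneg]

/-- A pre-Brownian motion has a modification all of whose paths are continuous. -/
theorem exists_continuous_modification (hB : IsPreBrownianReal B P) (mB : ∀ t, Measurable (B t)) :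
    ∃ C : ℝ≥0 → Ω → ℝ, (∀ t, Measurable (C t)) ∧ (∀ ω, Continuous (C · ω)) ∧
      ∀ t, C t =ᵐ[P] B t := by
  obtain ⟨c, hc0, hc⟩ := hB.exists_lintegral_sub_pow_four
  let Δ : ℕ → ℕ → Ω → ℝ := fun n k ω ↦ B ((k + 1 : ℕ) / 2 ^ n) ω - B (k / 2 ^ n) ω
  -- The weight is `1000 / 729 = (10 / 9) ^ 3`. Level `n` has `N * 2 ^ n` increments of fourth
  -- moment `c / 4 ^ n`, so its expected contribution is `N * c * (500 / 729) ^ n`, which is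
  -- summable.
  let T : ℕ → Ω → ℝ≥0∞ := fun N ω ↦ ∑' n, ∑ k ∈ Finset.range (N * 2 ^ n),
    ENNReal.ofReal ((1000 / 729) ^ n * Δ n k ω ^ 4)
  have mT : ∀ N, Measurable (T N) := fun N ↦ by fun_prop
  have hT : ∀ N, ∫⁻ ω, T N ω ∂P ≠ ∞ := by
    intro N
    have hq : Summable fun n : ℕ ↦ (N * c) * (500 / 729 : ℝ) ^ n :=
      (summable_geometric_of_lt_one (by norm_num) (by norm_num)).mul_left _
    have : ∫⁻ ω, T N ω ∂P = ∑' n : ℕ, ENNReal.ofReal ((N * c) * (500 / 729 : ℝ) ^ n) := by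
      rw [lintegral_tsum fun n ↦ by fun_prop]
      congr 1 with n
      rw [lintegral_finsetSum _ fun k _ ↦ by fun_prop]
      have hk : ∀ k ∈ Finset.range (N * 2 ^ n),
          ∫⁻ ω, ENNReal.ofReal ((1000 / 729) ^ n * Δ n k ω ^ 4) ∂P =
            ENNReal.ofReal ((1000 / 729) ^ n * (c * (1 / 2 ^ n) ^ 2)) := by
        intro k _
        simp_rw [ENNReal.ofReal_mul (p := (1000 / 729 : ℝ) ^ n) (by positivity)]
        rw [lintegral_const_mul _ (by fun_prop), hc, NNReal.dist_eq]
        congr 4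
        push_cast
        rw [← sub_div, add_sub_cancel_left, abs_of_nonneg (by positivity)]
      rw [Finset.sum_congr rfl hk, Finset.sum_const, Finset.card_range, nsmul_eq_mul,
        ← ENNReal.ofReal_natCast, ← ENNReal.ofReal_mul (by positivity)]
      congr 1
      rw [show (500 / 729 : ℝ) = 1000 / 729 / 2 by norm_num, div_pow _ (2 : ℝ)]
      push_cast
      field_simp
    rw [this]
    exact hq.tsum_ofReal_ne_top
  let G : Set Ω := {ω | ∀ N, T N ω ≠ ∞}
  have hG : MeasurableSet G := by
    have : G = ⋂ N, T N ⁻¹' {∞}ᶜ := by ext; simp [G]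
    rw [this]
    exact MeasurableSet.iInter fun N ↦ mT N (measurableSet_singleton _).compl
  have hGae : ∀ᵐ ω ∂P, ω ∈ G := ae_all_iff.2 fun N ↦
    (ae_lt_top (mT N) (hT N)).mono fun _ h ↦ h.ne
  have hpath : ∀ ω, ∃ y : ℝ≥0 → ℝ, Continuous y ∧
      -- Off the good set `G` the path is replaced by zero, so that the limit exists and is
      -- continuous for every `ω`.
      ∀ t, Tendsto (fun n ↦ G.indicator (B (dyadicFloor n t)) ω) atTop (𝓝 (y t)) := by
    intro ω
    by_cases hω : ω ∈ G
    · simp only [Set.indicator_of_mem hω]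
      refine exists_continuous_tendsto_dyadicFloor (x := (B · ω)) fun N ↦
        ⟨fun n ↦ (9 / 10) ^ n + (∑ k ∈ Finset.range (N * 2 ^ n),
          ENNReal.ofReal ((1000 / 729) ^ n * Δ n k ω ^ 4)).toReal,
          (summable_geometric_of_lt_one (by norm_num) (by norm_num)).add
            (ENNReal.summable_toReal (hω N)), fun n k hk ↦ ?_⟩
      have h1 : (1000 / 729) ^ n * Δ n k ω ^ 4 ≤ (∑ k ∈ Finset.range (N * 2 ^ n),
          ENNReal.ofReal ((1000 / 729) ^ n * Δ n k ω ^ 4)).toReal := by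
        rw [← ENNReal.ofReal_sum_of_nonneg fun k _ ↦ by positivity,
          ENNReal.toReal_ofReal (Finset.sum_nonneg fun k _ ↦ by positivity)]
        exact Finset.single_le_sum (f := fun k ↦ (1000 / 729 : ℝ) ^ n * Δ n k ω ^ 4)
          (fun k _ ↦ by positivity) (Finset.mem_range.2 hk)
      -- Either the increment is at most `(9 / 10) ^ n`, or its cube times `(1000 / 729) ^ n` is at
      -- least `1` and the weighted fourth power dominates it. This replaces Borel–Cantelli.
      have h2 : |Δ n k ω| ≤ (9 / 10) ^ n + (1000 / 729) ^ n * Δ n k ω ^ 4 := by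
        rw [← Even.pow_abs (show Even 4 by decide) (Δ n k ω)]
        set a := |Δ n k ω| with ha
        have ha0 : 0 ≤ a := abs_nonneg _
        rcases le_total a ((9 / 10) ^ n) with h | h
        · have : 0 ≤ (1000 / 729 : ℝ) ^ n * a ^ 4 := by positivity
          linarith
        · have h3 : 1 ≤ (1000 / 729 : ℝ) ^ n * a ^ 3 := by
            calc (1 : ℝ) = (1000 / 729) ^ n * ((9 / 10) ^ n) ^ 3 := by
                  rw [← pow_mul, mul_comm n 3, pow_mul, ← mul_pow]; norm_num
              _ ≤ _ := by gcongr
          have h4 : a * 1 ≤ a * ((1000 / 729 : ℝ) ^ n * a ^ 3) := by gcongr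
          have h5 : (0 : ℝ) ≤ (9 / 10) ^ n := by positivity
          nlinarith
      linarith
    · exact ⟨fun _ ↦ 0, continuous_const, fun t ↦ by simp [hω]⟩
  choose C hCcont hClim using hpath
  have mC : ∀ t, Measurable fun ω ↦ C ω t := fun t ↦
    measurable_of_tendsto_metrizable (fun n ↦ (mB (dyadicFloor n t)).indicator hG)
      (tendsto_pi_nhds.2 fun ω ↦ hClim ω t)
  refine ⟨fun t ω ↦ C ω t, mC, hCcont, fun t ↦ ?_⟩
  have hlim : ∀ᵐ ω ∂P, Tendsto (fun n ↦ ENNReal.ofReal ((B (dyadicFloor n t) ω - B t ω) ^ 4)) atTop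
      (𝓝 (ENNReal.ofReal ((C ω t - B t ω) ^ 4))) := by
    filter_upwards [hGae] with ω hω
    have := hClim ω t
    simp only [Set.indicator_of_mem hω] at this
    exact ENNReal.tendsto_ofReal ((this.sub_const _).pow 4)
  -- Fatou's lemma: the dyadic values converge to `B t` in fourth mean and to `C` almost surely, so
  -- the two limits agree.
  have hzero : ∫⁻ ω, ENNReal.ofReal ((C ω t - B t ω) ^ 4) ∂P = 0 := by
    refine le_antisymm ?_ zero_le
    calc ∫⁻ ω, ENNReal.ofReal ((C ω t - B t ω) ^ 4) ∂P
        = ∫⁻ ω, liminf (fun n ↦ ENNReal.ofReal ((B (dyadicFloor n t) ω - B t ω) ^ 4)) atTop ∂P :=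
          lintegral_congr_ae (hlim.mono fun ω h ↦ h.liminf_eq.symm)
      _ ≤ liminf (fun n ↦ ∫⁻ ω, ENNReal.ofReal ((B (dyadicFloor n t) ω - B t ω) ^ 4) ∂P) atTop :=
          lintegral_liminf_le fun n ↦ by fun_prop
      _ = 0 := by
          simp_rw [hc]
          have := (tendsto_iff_dist_tendsto_zero.1 (tendsto_dyadicFloor t)).pow 2 |>.const_mul c
          have := ENNReal.tendsto_ofReal this
          simpa using this.liminf_eq
  rw [lintegral_eq_zero_iff (by fun_prop)] at hzero
  filter_upwards [hzero] with ω hω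
  simp only [Pi.zero_apply, ENNReal.ofReal_eq_zero] at hω
  have : (C ω t - B t ω) ^ 4 = 0 := le_antisymm hω (by positivity)
  exact sub_eq_zero.1 (pow_eq_zero_iff (by norm_num) |>.1 this)

end ProbabilityTheory.IsPreBrownianReal

/-! ### Isometries determined by Gram matrices -/

section Isometry

variable {ι E F : Type*} [NormedAddCommGroup E] [InnerProductSpace ℝ E]
  [NormedAddCommGroup F] [InnerProductSpace ℝ F]

/-- Two families of vectors with the same Gram matrix are intertwined by a linear isometry,
provided that the first one spans a dense subspace. -/
theorem exists_linearIsometry_of_inner_eq [CompleteSpace F] {e : ι → E} {y : ι → F}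
    (h : ∀ i j, inner ℝ (e i) (e j) = inner ℝ (y i) (y j))
    (hd : DenseRange (Finsupp.linearCombination ℝ e)) :
    ∃ J : E →ₗᵢ[ℝ] F, ∀ i, J (e i) = y i := by
  -- The norm of a linear combination depends on the Gram matrix only.
  have hnorm : ∀ c, ‖Finsupp.linearCombination ℝ y c‖ = ‖Finsupp.linearCombination ℝ e c‖ := by
    intro c
    rw [← sq_eq_sq₀ (norm_nonneg _) (norm_nonneg _), ← real_inner_self_eq_norm_sq,
      ← real_inner_self_eq_norm_sq]
    simp only [Finsupp.linearCombination_apply, Finsupp.sum, sum_inner, inner_sum,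
      real_inner_smul_left, real_inner_smul_right, h]
  have hle : ∀ c, ‖Finsupp.linearCombination ℝ y c‖ ≤
      1 * ‖Finsupp.linearCombination ℝ e c‖ := fun c ↦ by rw [one_mul, hnorm]
  let L := (Finsupp.linearCombination ℝ y).extendOfNorm (Finsupp.linearCombination ℝ e)
  have hL : ∀ c, L (Finsupp.linearCombination ℝ e c) = Finsupp.linearCombination ℝ y c :=
    LinearMap.extendOfNorm_eq hd ⟨1, hle⟩
  refine ⟨⟨L.toLinearMap, fun x ↦ ?_⟩, fun i ↦ ?_⟩
  · refine hd.induction_on (p := fun x ↦ ‖L x‖ = ‖x‖) x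
      (isClosed_eq (by fun_prop) (by fun_prop)) fun c ↦ ?_
    rw [hL, hnorm]
  · simpa using hL (Finsupp.single i 1)

end Isometry

/-! ### Isometries into `L²(P)` with Gaussian values -/

section Gaussian

variable {Ω E : Type*} {mΩ : MeasurableSpace Ω} {P : Measure Ω}
  [NormedAddCommGroup E] [InnerProductSpace ℝ E]

/-- The map is 1-Lipschitz, by `|exp(ia) - exp(ib)| ≤ |a - b|` and the domination of the `L¹` norm
by the `L²` norm. It lets Gaussian characteristic functions pass to `L²` limits. -/
lemma continuous_integral_exp_I_Lp [IsProbabilityMeasure P] :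
    Continuous fun f : Lp ℝ 2 P ↦ ∫ ω, Complex.exp (Complex.I * f ω) ∂P := by
  have hint : ∀ f : Lp ℝ 2 P, Integrable (fun ω ↦ Complex.exp (Complex.I * f ω)) P := fun f ↦
    Integrable.of_bound (by fun_prop) 1 (ae_of_all _ fun ω ↦ by
      rw [mul_comm, Complex.norm_exp_ofReal_mul_I])
  refine (LipschitzWith.of_dist_le_mul (K := 1) fun f g ↦ ?_).continuous
  have hfg : Integrable (fun ω ↦ f ω - g ω) P :=
    ((Lp.memLp f).integrable (by norm_num)).sub ((Lp.memLp g).integrable (by norm_num))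
  rw [dist_eq_norm, dist_eq_norm, ← integral_sub (hint f) (hint g), NNReal.coe_one, one_mul]
  calc ‖∫ ω, (Complex.exp (Complex.I * f ω) - Complex.exp (Complex.I * g ω)) ∂P‖
      ≤ ∫ ω, ‖f ω - g ω‖ ∂P := by
        refine norm_integral_le_of_norm_le hfg.norm (ae_of_all _ fun ω ↦ ?_)
        have : Complex.exp (Complex.I * f ω) - Complex.exp (Complex.I * g ω) =
            Complex.exp (Complex.I * g ω) *
              (Complex.exp (Complex.I * ((f ω - g ω : ℝ) : ℂ)) - 1) := by
          rw [mul_sub, ← Complex.exp_add, mul_one]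
          push_cast
          ring_nf
        rw [this, norm_mul, mul_comm Complex.I (g ω : ℂ), Complex.norm_exp_ofReal_mul_I, one_mul]
        exact Real.norm_exp_I_mul_ofReal_sub_one_le
    _ ≤ ‖f - g‖ := by
        rw [integral_norm_eq_lintegral_enorm hfg.aestronglyMeasurable, ← eLpNorm_one_eq_lintegral_enorm,
          Lp.norm_def]
        refine ENNReal.toReal_mono (Lp.eLpNorm_ne_top _) ?_
        rw [eLpNorm_congr_ae (Lp.coeFn_sub f g)]
        exact eLpNorm_le_eLpNorm_of_exponent_le (by norm_num) hfg.aestronglyMeasurable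

/-- If an isometry into `L²(P)` maps a dense set to centered Gaussian variables, then all its values
are centered Gaussian variables. -/
theorem LinearIsometry.hasLaw_gaussianReal [IsProbabilityMeasure P] {ι : Type*}
    (J : E →ₗᵢ[ℝ] Lp ℝ 2 P) {e : ι → E}
    (he : DenseRange e) (hG : ∀ i, HasGaussianLaw (J (e i)) P) (h0 : ∀ i, P[J (e i)] = 0) (x : E) :
    HasLaw (J x) (gaussianReal 0 (‖x‖₊ ^ 2)) P := by
  have hchar : ∀ x, ∫ ω, Complex.exp (Complex.I * J x ω) ∂P = Complex.exp (-(‖x‖ ^ 2) / 2) := by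
    intro x
    refine he.induction_on
      (p := fun x ↦ ∫ ω, Complex.exp (Complex.I * J x ω) ∂P = Complex.exp (-(‖x‖ ^ 2) / 2)) x
      (isClosed_eq (continuous_integral_exp_I_Lp.comp J.continuous) (by fun_prop)) fun i ↦ ?_
    have hvar : Var[J (e i); P] = ‖e i‖ ^ 2 := by
      rw [variance_of_integral_eq_zero (hG i).aemeasurable (h0 i), ← J.norm_map,
        ← real_inner_self_eq_norm_sq, L2.inner_def]
      congr 1 with ω
      simp [sq]
    have := congrFun (congrArg charFun (hG i).map_eq_gaussianReal) 1
    rw [charFun_apply_real, charFun_gaussianReal, h0, hvar,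
      integral_map (hG i).aemeasurable (by fun_prop)] at this
    convert this using 2
    · ext ω; congr 1; push_cast; ring
    · push_cast
      rw [Real.coe_toNNReal _ (by positivity)]
      push_cast
      ring
  refine ⟨(Lp.aestronglyMeasurable _).aemeasurable, Measure.ext_of_charFun ?_⟩
  ext t
  rw [charFun_apply_real, charFun_gaussianReal,
    integral_map (Lp.aestronglyMeasurable _).aemeasurable (by fun_prop)]
  -- By linearity of `J`, the characteristic function of `J x` at `t` is that of `J (t • x)` at `1`.
  have h1 := hchar (t • x)
  rw [map_smul] at h1
  have h2 : ∫ ω, Complex.exp (Complex.I * (t • J x) ω) ∂P =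
      ∫ ω, Complex.exp (t * J x ω * Complex.I) ∂P := by
    refine integral_congr_ae ?_
    filter_upwards [Lp.coeFn_smul t (J x)] with ω hω
    rw [hω]
    simp only [Pi.smul_apply, smul_eq_mul]
    push_cast
    ring_nf
  rw [← h2, h1, norm_smul]
  congr 1
  have : ((‖t‖ : ℝ) : ℂ) ^ 2 = (t : ℂ) ^ 2 := by
    rw [Real.norm_eq_abs]; exact_mod_cast congrArg Complex.ofReal (sq_abs t)
  push_cast
  rw [mul_pow, this]
  ring

lemma isonormal_integral_eq_zero {J : E →ₗᵢ[ℝ] Lp ℝ 2 P}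
    (hJ : ∀ x, HasLaw (J x) (gaussianReal 0 (‖x‖₊ ^ 2)) P) (x : E) : P[J x] = 0 := by
  rw [(hJ x).integral_eq, integral_id_gaussianReal]

lemma isonormal_covariance_eq_inner [IsProbabilityMeasure P] {J : E →ₗᵢ[ℝ] Lp ℝ 2 P}
    (hJ : ∀ x, HasLaw (J x) (gaussianReal 0 (‖x‖₊ ^ 2)) P) (x y : E) : cov[J x, J y; P] = inner ℝ x y := by
  rw [covariance_eq_sub (Lp.memLp _) (Lp.memLp _), isonormal_integral_eq_zero hJ, zero_mul,
    sub_zero, ← J.inner_map_map, L2.inner_def]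
  congr 1 with ω
  simp [mul_comm]

/-- A linear functional of finitely many values of `J` is, by linearity, again a value of `J`, hence
Gaussian: joint Gaussianity comes for free. -/
lemma isonormal_isGaussianProcess [IsProbabilityMeasure P] {J : E →ₗᵢ[ℝ] Lp ℝ 2 P}
    (hJ : ∀ x, HasLaw (J x) (gaussianReal 0 (‖x‖₊ ^ 2)) P) :
    IsGaussianProcess (fun x ω ↦ J x ω) P where
  hasGaussianLaw I := by
    classical
    have am : AEMeasurable (fun ω ↦ I.restrict fun x ↦ J x ω) P :=
      aemeasurable_pi_lambda _ fun x ↦ (hJ x).aemeasurable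
    refine ⟨⟨fun L ↦ ?_⟩⟩
    have hL : L ∘ (fun ω ↦ I.restrict fun x ↦ J x ω) =ᵐ[P]
        J (∑ i : I, L (Pi.single i 1) • (i : E)) := by
      rw [map_sum]
      simp only [map_smul]
      have h1 : ∀ᵐ ω ∂P, ∀ i : I, (L (Pi.single i 1) • J i : Lp ℝ 2 P) ω =
          L (Pi.single i 1) * J i ω := ae_all_iff.2 fun i ↦ Lp.coeFn_smul _ _
      filter_upwards [Lp.coeFn_finsetSum Finset.univ
        (fun i : I ↦ L (Pi.single i 1) • J i), h1] with ω hω h1ω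
      rw [hω, Finset.sum_apply]
      simp only [h1ω, Function.comp_apply]
      conv_lhs => rw [← Finset.univ_sum_single (I.restrict fun x ↦ J x ω), map_sum]
      congr 1 with i
      rw [mul_comm, ← smul_eq_mul, ← map_smul, ← Pi.single_smul']
      simp
    have hlaw := ((hJ _).congr hL).hasGaussianLaw
    have := hlaw.map_eq_gaussianReal
    rw [AEMeasurable.map_map_of_aemeasurable (by fun_prop) am, this]
    congr 1
    · rw [integral_map am (by fun_prop)]; rfl
    · rw [variance_map (by fun_prop) am]

end Gaussian

/-! ### Truncated functions in `L²(0, ∞)` -/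

section Truncation

/-- The Hilbert space `L²(0, ∞)`. -/
abbrev L2Pos : Type := Lp ℝ 2 (volume.restrict (Set.Ioi (0 : ℝ)))

lemma Ioc_zero_inter_Ioi_zero (t : ℝ) : Set.Ioc 0 t ∩ Set.Ioi 0 = Set.Ioc 0 t :=
  Set.inter_eq_left.2 fun _ h ↦ h.1

/-- The class in `L²(0, ∞)` of `1_{(0, t]} f` for `f ∈ L²(0, t)`. -/
noncomputable def truncLp (f : ℝ → ℝ) (t : ℝ) (hf : MemLp f 2 (volume.restrict (Set.Ioc 0 t))) :
    L2Pos :=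
  MemLp.toLp ((Set.Ioc 0 t).indicator f) <| by
    rwa [memLp_indicator_iff_restrict measurableSet_Ioc,
      Measure.restrict_restrict measurableSet_Ioc, Ioc_zero_inter_Ioi_zero]

lemma coeFn_truncLp {f : ℝ → ℝ} {t : ℝ} (hf : MemLp f 2 (volume.restrict (Set.Ioc 0 t))) :
    truncLp f t hf =ᵐ[volume.restrict (Set.Ioi (0 : ℝ))] (Set.Ioc 0 t).indicator f :=
  MemLp.coeFn_toLp _

lemma inner_truncLp_left {f : ℝ → ℝ} {t : ℝ} (hf : MemLp f 2 (volume.restrict (Set.Ioc 0 t)))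
    (φ : L2Pos) : inner ℝ (truncLp f t hf) φ = ∫ u in Set.Ioc 0 t, f u * φ u := by
  rw [L2.inner_def, ← Ioc_zero_inter_Ioi_zero t, ← Measure.restrict_restrict measurableSet_Ioc,
    ← integral_indicator measurableSet_Ioc]
  refine integral_congr_ae ?_
  filter_upwards [coeFn_truncLp hf] with u hu
  rw [hu, Set.indicator_mul_left]
  simp [mul_comm]

lemma inner_truncLp_truncLp {f g : ℝ → ℝ} {s t : ℝ}
    (hf : MemLp f 2 (volume.restrict (Set.Ioc 0 s)))
    (hg : MemLp g 2 (volume.restrict (Set.Ioc 0 t))) :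
    inner ℝ (truncLp f s hf) (truncLp g t hg) = ∫ u in Set.Ioc 0 (min s t), f u * g u := by
  have hg' : truncLp g t hg =ᵐ[volume.restrict (Set.Ioc 0 s)] (Set.Ioc 0 t).indicator g :=
    ae_restrict_of_ae_restrict_of_subset (fun _ h ↦ h.1) (coeFn_truncLp hg)
  rw [inner_truncLp_left]
  have : ∫ u in Set.Ioc 0 s, f u * truncLp g t hg u =
      ∫ u in Set.Ioc 0 s, (Set.Ioc 0 t).indicator (fun u ↦ f u * g u) u := by
    refine integral_congr_ae ?_
    filter_upwards [hg'] with u hu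
    rw [hu, Set.indicator_mul_right]
  rw [this, integral_indicator measurableSet_Ioc, Measure.restrict_restrict measurableSet_Ioc,
    Set.Ioc_inter_Ioc, max_self, min_comm]

/-- The functions `1_{(0, t]} h` span a dense subspace of `L²(0, ∞)` if `h` does not vanish. -/
theorem denseRange_linearCombination_truncLp {h : ℝ → ℝ}
    (hh : ∀ t : ℝ≥0, MemLp h 2 (volume.restrict (Set.Ioc 0 (t : ℝ)))) (hne : ∀ u, 0 < u → h u ≠ 0) :
    DenseRange (Finsupp.linearCombination ℝ fun t : ℝ≥0 ↦ truncLp h t (hh t)) := by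
  rw [DenseRange, ← LinearMap.coe_range, Finsupp.range_linearCombination,
    Submodule.dense_iff_topologicalClosure_eq_top, Submodule.topologicalClosure_eq_top_iff,
    Submodule.eq_bot_iff]
  intro φ hφ
  -- For `φ` orthogonal to all the truncations, the primitive of `h * φ` vanishes identically;
  -- Lebesgue differentiation then gives `h * φ = 0` almost everywhere.
  have horth : ∀ t : ℝ, 0 ≤ t → ∫ u in (0 : ℝ)..t, h u * φ u = 0 := by
    intro t ht
    rw [intervalIntegral.integral_of_le ht]
    have := (Submodule.mem_orthogonal _ _).1 hφ _
      (Submodule.subset_span (Set.mem_range_self (⟨t, ht⟩ : ℝ≥0)))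
    rwa [inner_truncLp_left] at this
  have hii : ∀ N : ℕ, IntervalIntegrable (fun u ↦ h u * φ u) volume 0 N := by
    intro N
    rw [intervalIntegrable_iff_integrableOn_Ioc_of_le (by positivity)]
    have h1 : MemLp φ 2 (volume.restrict (Set.Ioc 0 (N : ℝ))) :=
      (Lp.memLp φ).mono_measure (Measure.restrict_mono (fun _ h ↦ h.1) le_rfl)
    exact (hh N).integrable_mul h1
  have hae : ∀ᵐ u : ℝ, ∀ N : ℕ, u ∈ Set.uIcc (0 : ℝ) N → ∀ c ∈ Set.uIcc (0 : ℝ) N,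
      HasDerivAt (fun x ↦ ∫ v in c..x, h v * φ v) (h u * φ u) u :=
    ae_all_iff.2 fun N ↦ (hii N).ae_hasDerivAt_integral
  rw [Lp.eq_zero_iff_ae_eq_zero]
  filter_upwards [ae_restrict_of_ae hae, ae_restrict_mem measurableSet_Ioi] with u hu hu0
  obtain ⟨N, hN⟩ := exists_nat_gt u
  have hmem : u ∈ Set.uIcc (0 : ℝ) N := by
    rw [Set.uIcc_of_le (by positivity)]
    exact ⟨le_of_lt hu0, hN.le⟩
  have hd := hu N hmem 0 Set.left_mem_uIcc
  have hz : (fun x ↦ ∫ v in (0 : ℝ)..x, h v * φ v) =ᶠ[𝓝 u] fun _ ↦ 0 := by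
    filter_upwards [lt_mem_nhds hu0] with x hx using horth x (le_of_lt hx)
  have h0 : h u * φ u = 0 := hd.unique ((hasDerivAt_const u (0 : ℝ)).congr_of_eventuallyEq hz)
  exact (mul_eq_zero.1 h0).resolve_left (hne u hu0)

end Truncation

/-! ### Wiener integrals as values of the isometry -/

section WienerIntegral

variable {Ω : Type*} {mΩ : MeasurableSpace Ω} {P : Measure Ω}

lemma memLp_one_Ioc (t : ℝ) : MemLp (fun _ ↦ (1 : ℝ)) 2 (volume.restrict (Set.Ioc 0 t)) :=
  memLp_const 1

/-- The class in `L²(0, ∞)` of a step function. -/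
noncomputable def StepFunction.toLp {T : ℝ≥0} (φ : StepFunction T) : L2Pos :=
  ∑ i, φ.c i • (truncLp (fun _ ↦ 1) (φ.b i) (memLp_one_Ioc _) -
    truncLp (fun _ ↦ 1) (φ.a i) (memLp_one_Ioc _))

lemma StepFunction.coeFn_toLp {T : ℝ≥0} (φ : StepFunction T) :
    φ.toLp =ᵐ[volume.restrict (Set.Ioi (0 : ℝ))] φ.eval := by
  have h1 : ∀ᵐ u ∂volume.restrict (Set.Ioi (0 : ℝ)), ∀ i,
      (φ.c i • (truncLp (fun _ ↦ 1) (φ.b i) (memLp_one_Ioc _) -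
        truncLp (fun _ ↦ 1) (φ.a i) (memLp_one_Ioc _)) : L2Pos) u =
      (Set.Ioc (φ.a i : ℝ) (φ.b i)).indicator (fun _ ↦ φ.c i) u := by
    refine ae_all_iff.2 fun i ↦ ?_
    filter_upwards [Lp.coeFn_smul (φ.c i) (truncLp (fun _ ↦ 1) (φ.b i) (memLp_one_Ioc _) -
        truncLp (fun _ ↦ 1) (φ.a i) (memLp_one_Ioc _)),
      Lp.coeFn_sub (truncLp (fun _ ↦ 1) (φ.b i) (memLp_one_Ioc _))
        (truncLp (fun _ ↦ 1) (φ.a i) (memLp_one_Ioc _)),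
      coeFn_truncLp (memLp_one_Ioc (φ.b i)), coeFn_truncLp (memLp_one_Ioc (φ.a i)),
      ae_restrict_mem measurableSet_Ioi] with u h1 h2 h3 h4 hu
    rw [h1, Pi.smul_apply, h2, Pi.sub_apply, h3, h4]
    have hu' : (0 : ℝ) < u := hu
    have hab : (φ.a i : ℝ) ≤ φ.b i := φ.a_le_b i
    by_cases ha : u ≤ φ.a i
    · have hb : u ≤ φ.b i := ha.trans hab
      simp [Set.indicator, hu', ha, hb, not_lt.2 ha]
    · by_cases hb : u ≤ φ.b i <;> simp [Set.indicator, hu', ha, hb, not_le.1 ha]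
  filter_upwards [Lp.coeFn_finsetSum Finset.univ fun i ↦
    φ.c i • (truncLp (fun _ ↦ 1) (φ.b i) (memLp_one_Ioc _) -
      truncLp (fun _ ↦ 1) (φ.a i) (memLp_one_Ioc _)), h1] with u h2 h1
  rw [StepFunction.toLp, h2, Finset.sum_apply, StepFunction.eval]
  exact Finset.sum_congr rfl fun i _ ↦ h1 i

lemma StepFunction.map_toLp_ae_eq {T : ℝ≥0} (φ : StepFunction T) (J : L2Pos →ₗᵢ[ℝ] Lp ℝ 2 P)
    {β : ℝ≥0 → Ω → ℝ} (hβ : ∀ t, β t =ᵐ[P] J (truncLp (fun _ ↦ 1) t (memLp_one_Ioc _))) :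
    J φ.toLp =ᵐ[P] φ.integral β := by
  have h1 : ∀ᵐ ω ∂P, ∀ i,
      (φ.c i • (J (truncLp (fun _ ↦ 1) (φ.b i) (memLp_one_Ioc _)) -
        J (truncLp (fun _ ↦ 1) (φ.a i) (memLp_one_Ioc _))) : Lp ℝ 2 P) ω =
      φ.c i * (β (φ.b i) ω - β (φ.a i) ω) := by
    refine ae_all_iff.2 fun i ↦ ?_
    filter_upwards [Lp.coeFn_smul (φ.c i) (J (truncLp (fun _ ↦ 1) (φ.b i) (memLp_one_Ioc _)) -
        J (truncLp (fun _ ↦ 1) (φ.a i) (memLp_one_Ioc _))),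
      Lp.coeFn_sub (J (truncLp (fun _ ↦ 1) (φ.b i) (memLp_one_Ioc _)))
        (J (truncLp (fun _ ↦ 1) (φ.a i) (memLp_one_Ioc _))),
      hβ (φ.a i), hβ (φ.b i)] with ω h1 h2 h3 h4
    rw [h1, Pi.smul_apply, h2, Pi.sub_apply, h3, h4, smul_eq_mul]
  simp only [StepFunction.toLp, map_sum, map_smul, map_sub]
  filter_upwards [Lp.coeFn_finsetSum Finset.univ fun i ↦
    φ.c i • (J (truncLp (fun _ ↦ 1) (φ.b i) (memLp_one_Ioc _)) -
      J (truncLp (fun _ ↦ 1) (φ.a i) (memLp_one_Ioc _))), h1] with ω h2 h1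
  rw [h2, Finset.sum_apply, StepFunction.integral]
  exact Finset.sum_congr rfl fun i _ ↦ h1 i

lemma StepFunction.eval_eq_zero {T : ℝ≥0} (φ : StepFunction T) {u : ℝ}
    (hu : u ∉ Set.Ioc (0 : ℝ) T) : φ.eval u = 0 :=
  Finset.sum_eq_zero fun i _ ↦ Set.indicator_of_notMem
    (fun h ↦ hu ⟨(φ.a i).2.trans_lt h.1, h.2.trans (φ.b_le i)⟩) _

/-- The step function `∑ cₛ 1_{(0, s ∧ T]}`. -/
noncomputable def StepFunction.ofFinsupp (T : ℝ≥0) (c : ℝ≥0 →₀ ℝ) : StepFunction T where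
  n := c.support.card
  a _ := 0
  b i := min (c.support.equivFin.symm i) T
  c i := c (c.support.equivFin.symm i)
  a_le_b _ := zero_le
  b_le _ := min_le_right _ _

lemma StepFunction.eval_ofFinsupp (T : ℝ≥0) (c : ℝ≥0 →₀ ℝ) (u : ℝ) :
    (StepFunction.ofFinsupp T c).eval u =
      (Set.Ioc (0 : ℝ) T).indicator
        (fun u ↦ c.sum fun s x ↦ x * (Set.Ioc (0 : ℝ) s).indicator (fun _ ↦ 1) u) u := by
  by_cases hu : u ∈ Set.Ioc (0 : ℝ) T
  · rw [Set.indicator_of_mem hu, Finsupp.sum, ← Finset.sum_coe_sort, StepFunction.eval]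
    refine Fintype.sum_equiv c.support.equivFin.symm _ _ fun i ↦ ?_
    simp [StepFunction.ofFinsupp, Set.indicator, hu.1, hu.2]
  · rw [Set.indicator_of_notMem hu, StepFunction.eval_eq_zero _ hu]

/-- An isometry `J : L²(0, ∞) → L²(P)` mapping `1_{(0, t]}` to `β_t` maps `1_{(0, T]} f` to the
Wiener integral of `f` over `(0, T]`. -/
theorem isWienerIntegral_truncLp (J : L2Pos →ₗᵢ[ℝ] Lp ℝ 2 P) {β : ℝ≥0 → Ω → ℝ}
    (hβ : ∀ t, β t =ᵐ[P] J (truncLp (fun _ ↦ 1) t (memLp_one_Ioc _))) {f : ℝ → ℝ} {T : ℝ≥0}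
    (hf : MemLp f 2 (volume.restrict (Set.Ioc 0 (T : ℝ)))) :
    IsWienerIntegral β P f T (J (truncLp f T hf)) := by
  have hd := denseRange_linearCombination_truncLp (fun t ↦ memLp_one_Ioc t)
    fun _ _ ↦ one_ne_zero
  obtain ⟨x, hx, hlim⟩ := mem_closure_iff_seq_limit.1 (hd (truncLp f T hf))
  choose c hc using hx
  have hdist : Tendsto (fun k ↦ ‖truncLp f T hf - (StepFunction.ofFinsupp T (c k)).toLp‖)
      atTop (𝓝 0) := by
    refine squeeze_zero (fun _ ↦ norm_nonneg _) (fun k ↦ ?_)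
      (tendsto_iff_norm_sub_tendsto_zero.1 hlim)
    rw [norm_sub_rev (x k)]
    -- Cutting the approximants off at `T` can only reduce the distance to a function supported in
    -- `(0, T]`.
    refine Lp.norm_le_norm_of_ae_le ?_
    have hx : (x k : ℝ → ℝ) =ᵐ[volume.restrict (Set.Ioi (0 : ℝ))]
        fun u ↦ (c k).sum fun s x ↦ x * (Set.Ioc (0 : ℝ) s).indicator (fun _ ↦ 1) u := by
      rw [← hc, Finsupp.linearCombination_apply, Finsupp.sum]
      have h1 : ∀ᵐ u ∂volume.restrict (Set.Ioi (0 : ℝ)), ∀ s : (c k).support,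
          (c k s • truncLp (fun _ ↦ 1) (s : ℝ≥0) (memLp_one_Ioc _) : L2Pos) u =
            c k s * (Set.Ioc (0 : ℝ) (s : ℝ≥0)).indicator (fun _ ↦ 1) u := by
        refine ae_all_iff.2 fun s ↦ ?_
        filter_upwards [Lp.coeFn_smul (c k s)
          (truncLp (fun _ ↦ 1) (s : ℝ≥0) (memLp_one_Ioc _)),
          coeFn_truncLp (memLp_one_Ioc (s : ℝ≥0))] with u h1 h2
        rw [h1, Pi.smul_apply, h2, smul_eq_mul]
      filter_upwards [Lp.coeFn_finsetSum (c k).support fun s ↦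
        (c k s • truncLp (fun _ ↦ 1) s (memLp_one_Ioc _) : L2Pos), h1] with u h2 h1
      rw [h2, Finset.sum_apply, Finsupp.sum]
      exact Finset.sum_congr rfl fun s hs ↦ h1 ⟨s, hs⟩
    filter_upwards [Lp.coeFn_sub (truncLp f T hf) (StepFunction.ofFinsupp T (c k)).toLp,
      Lp.coeFn_sub (truncLp f T hf) (x k), coeFn_truncLp hf,
      (StepFunction.ofFinsupp T (c k)).coeFn_toLp, hx] with u h1 h2 h3 h4 h5
    rw [h1, h2, Pi.sub_apply, Pi.sub_apply, h3, h4, h5, StepFunction.eval_ofFinsupp]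
    by_cases hu : u ∈ Set.Ioc (0 : ℝ) T
    · simp only [Set.indicator_of_mem hu]; exact le_rfl
    · simp only [Set.indicator_of_notMem hu, sub_self, norm_zero]; exact norm_nonneg _
  have henorm : Tendsto (fun k ↦ ‖truncLp f T hf - (StepFunction.ofFinsupp T (c k)).toLp‖ₑ)
      atTop (𝓝 0) := by
    simpa [ofReal_norm] using ENNReal.tendsto_ofReal hdist
  refine ⟨fun k ↦ StepFunction.ofFinsupp T (c k), ?_, ?_⟩
  · convert henorm using 2 with k
    rw [Lp.enorm_def, ← Ioc_zero_inter_Ioi_zero (T : ℝ),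
      ← Measure.restrict_restrict measurableSet_Ioc,
      ← eLpNorm_indicator_eq_eLpNorm_restrict measurableSet_Ioc]
    refine eLpNorm_congr_ae ?_
    filter_upwards [Lp.coeFn_sub (truncLp f T hf) (StepFunction.ofFinsupp T (c k)).toLp,
      coeFn_truncLp hf, (StepFunction.ofFinsupp T (c k)).coeFn_toLp] with u h1 h2 h3
    rw [h1, Pi.sub_apply, h2, h3]
    by_cases hu : u ∈ Set.Ioc (0 : ℝ) T
    · simp only [Set.indicator_of_mem hu]
    · simp only [Set.indicator_of_notMem hu, StepFunction.eval_eq_zero _ hu, sub_self]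
  · convert henorm using 2 with k
    rw [← ofReal_norm, ← J.norm_map, map_sub, ofReal_norm, Lp.enorm_def]
    refine eLpNorm_congr_ae ?_
    filter_upwards [Lp.coeFn_sub (J (truncLp f T hf)) (J (StepFunction.ofFinsupp T (c k)).toLp),
      (StepFunction.ofFinsupp T (c k)).map_toLp_ae_eq J hβ] with ω h1 h2
    rw [h1, Pi.sub_apply, h2]

lemma IsWienerIntegral.congr {β : ℝ≥0 → Ω → ℝ} {f : ℝ → ℝ} {T : ℝ≥0} {I I' : Ω → ℝ}
    (hI : IsWienerIntegral β P f T I) (h : I =ᵐ[P] I') : IsWienerIntegral β P f T I' := by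
  obtain ⟨φ, h1, h2⟩ := hI
  refine ⟨φ, h1, h2.congr fun k ↦ eLpNorm_congr_ae ?_⟩
  filter_upwards [h] with ω hω
  rw [hω]

end WienerIntegral

/-! ### Integration by parts for the Wiener integral -/

/-- Summation by parts. -/
lemma sum_range_mul_sub_by_parts (u y : ℕ → ℝ) (hu : u 0 = 0) (n : ℕ) :
    ∑ i ∈ Finset.range n, u i * (y (i + 1) - y i) =
      u n * y n - ∑ i ∈ Finset.range n, (u (i + 1) - u i) * y (i + 1) := by
  induction n with
  | zero => simp [hu]
  | succ n ih => rw [Finset.sum_range_succ, Finset.sum_range_succ, ih]; ring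

/-- The Riemann-Stieltjes sums of `u ↦ u` against a continuous function `y` over the uniform
partitions of `[0, t]`. -/
lemma tendsto_sum_mul_sub_of_continuous {y : ℝ → ℝ} (hy : Continuous y) {t : ℝ} (ht : 0 ≤ t) :
    Tendsto (fun n : ℕ ↦ ∑ i ∈ Finset.range (n + 1), (i * t / (n + 1)) *
        (y ((i + 1 : ℕ) * t / (n + 1)) - y (i * t / (n + 1)))) atTop
      (𝓝 (t * y t - ∫ u in (0 : ℝ)..t, y u)) := by
  have hpart : ∀ n : ℕ, ∑ i ∈ Finset.range (n + 1), (i * t / (n + 1)) *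
        (y ((i + 1 : ℕ) * t / (n + 1)) - y (i * t / (n + 1))) =
      t * y t - ∑ i ∈ Finset.range (n + 1),
        (((i + 1 : ℕ) : ℝ) * t / (n + 1) - i * t / (n + 1)) * y ((i + 1 : ℕ) * t / (n + 1)) := by
    intro n
    rw [sum_range_mul_sub_by_parts (fun i ↦ (i : ℝ) * t / (n + 1)) (fun i ↦ y (i * t / (n + 1)))
      (by simp)]
    have : ((n + 1 : ℕ) : ℝ) * t / (n + 1) = t := by push_cast; field_simp
    simp only [this]
  simp_rw [hpart]
  refine tendsto_const_nhds.sub ?_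
  rw [Metric.tendsto_atTop]
  intro ε hε
  -- Dividing by `t + 1` makes the total error `ε * t / (t + 1)`, strictly below `ε` even for `t =
  -- 0`.
  have hδ : 0 < ε / (t + 1) := by positivity
  obtain ⟨δ, hδ0, hδ⟩ := Metric.uniformContinuousOn_iff.1
    (isCompact_Icc.uniformContinuousOn_of_continuous hy.continuousOn (s := Set.Icc 0 t)) _ hδ
  obtain ⟨n₀, hn₀⟩ := exists_nat_gt (t / δ)
  refine ⟨n₀, fun n hn ↦ ?_⟩
  have hn1 : (0 : ℝ) < n + 1 := by positivity
  have hmesh : t / (n + 1) < δ := by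
    rw [div_lt_iff₀ hδ0] at hn₀
    rw [div_lt_iff₀ hn1]
    have : (n₀ : ℝ) ≤ n := by exact_mod_cast hn
    nlinarith
  have hsplit : ∑ i ∈ Finset.range (n + 1),
      ∫ u in ((i : ℝ) * t / (n + 1))..((i + 1 : ℕ) * t / (n + 1)), y u =
        ∫ u in (0 : ℝ)..t, y u := by
    rw [intervalIntegral.sum_integral_adjacent_intervals (a := fun i : ℕ ↦ (i : ℝ) * t / (n + 1))
      fun k _ ↦ hy.intervalIntegrable _ _]
    congr 1
    · simp
    · push_cast; field_simp
  rw [← hsplit, dist_eq_norm, ← Finset.sum_sub_distrib]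
  have hbound : ∀ i ∈ Finset.range (n + 1),
      ‖(((i + 1 : ℕ) : ℝ) * t / (n + 1) - i * t / (n + 1)) * y ((i + 1 : ℕ) * t / (n + 1)) -
        ∫ u in ((i : ℝ) * t / (n + 1))..((i + 1 : ℕ) * t / (n + 1)), y u‖ ≤
      ε / (t + 1) * (t / (n + 1)) := by
    intro i hi
    have hin : ((i + 1 : ℕ) : ℝ) ≤ n + 1 := by exact_mod_cast Finset.mem_range.1 hi
    have hlen : ((i + 1 : ℕ) : ℝ) * t / (n + 1) - i * t / (n + 1) = t / (n + 1) := by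
      push_cast; ring
    have hle : (i : ℝ) * t / (n + 1) ≤ (i + 1 : ℕ) * t / (n + 1) := by
      rw [← sub_nonneg, hlen]; positivity
    have hconst : (((i + 1 : ℕ) : ℝ) * t / (n + 1) - i * t / (n + 1)) *
        y ((i + 1 : ℕ) * t / (n + 1)) =
        ∫ _ in ((i : ℝ) * t / (n + 1))..((i + 1 : ℕ) * t / (n + 1)),
          y ((i + 1 : ℕ) * t / (n + 1)) := by
      rw [intervalIntegral.integral_const, smul_eq_mul]
    rw [hconst, ← intervalIntegral.integral_sub intervalIntegrable_const
      (hy.intervalIntegrable _ _)]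
    refine (intervalIntegral.norm_integral_le_of_norm_le_const (C := ε / (t + 1))
      fun u hu ↦ ?_).trans_eq ?_
    · rw [Set.uIoc_of_le hle] at hu
      have hlo : (0 : ℝ) ≤ i * t / (n + 1) := by positivity
      have hhi : ((i + 1 : ℕ) : ℝ) * t / (n + 1) ≤ t := by
        rw [div_le_iff₀ hn1, mul_comm]
        gcongr
      rw [← dist_eq_norm]
      refine (hδ _ ⟨hlo.trans hle, hhi⟩ _ ⟨hlo.trans hu.1.le, hu.2.trans hhi⟩ ?_).le
      rw [Real.dist_eq, abs_of_nonneg (sub_nonneg.2 hu.2)]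
      linarith [hu.1]
    · rw [hlen, abs_of_nonneg (by positivity)]
  refine ((norm_sum_le _ _).trans (Finset.sum_le_sum hbound)).trans_lt ?_
  rw [Finset.sum_const, Finset.card_range, nsmul_eq_mul]
  push_cast
  calc ((n : ℝ) + 1) * (ε / (t + 1) * (t / (n + 1))) = ε * (t / (t + 1)) := by field_simp
    _ < ε * 1 := by
        gcongr
        rw [div_lt_one (by positivity)]
        linarith
    _ = ε := mul_one ε

lemma MeasureTheory.MemLp.id_mul_Ioc {h : ℝ → ℝ} {t : ℝ}
    (hh : MemLp h 2 (volume.restrict (Set.Ioc 0 t))) :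
    MemLp (fun u ↦ u * h u) 2 (volume.restrict (Set.Ioc 0 t)) := by
  refine hh.of_le_mul (c := t) (aestronglyMeasurable_id.mul hh.1) ?_
  filter_upwards [ae_restrict_mem measurableSet_Ioc] with u hu
  rw [norm_mul, Real.norm_of_nonneg hu.1.le]
  gcongr
  exact hu.2

/-- The step approximations `∑ uᵢ 1_{(uᵢ, uᵢ₊₁]} h` converge to `1_{(0, t]} u h(u)` in `L²`. -/
lemma tendsto_sum_smul_truncLp {h : ℝ → ℝ}
    (hh : ∀ t : ℝ≥0, MemLp h 2 (volume.restrict (Set.Ioc 0 (t : ℝ)))) (t : ℝ≥0) :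
    Tendsto (fun n : ℕ ↦ ∑ i ∈ Finset.range (n + 1), ((i * t / (n + 1) : ℝ≥0) : ℝ) •
        (truncLp h ((i + 1 : ℕ) * t / (n + 1) : ℝ≥0) (hh _) -
          truncLp h (i * t / (n + 1) : ℝ≥0) (hh _))) atTop
      (𝓝 (truncLp (fun u ↦ u * h u) t (hh t).id_mul_Ioc)) := by
  rw [tendsto_iff_norm_sub_tendsto_zero]
  have hlim : Tendsto (fun n : ℕ ↦ (t : ℝ) * ‖truncLp h t (hh t)‖ * (1 / ((n : ℝ) + 1)))
      atTop (𝓝 0) := by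
    simpa using tendsto_one_div_add_atTop_nhds_zero_nat.const_mul ((t : ℝ) * ‖truncLp h t (hh t)‖)
  refine squeeze_zero (fun _ ↦ norm_nonneg _) (fun n ↦ ?_) hlim
  rw [norm_sub_rev, mul_right_comm]
  refine Lp.norm_le_mul_norm_of_ae_le_mul ?_
  set p : ℕ → ℝ≥0 := fun i ↦ (i * t / (n + 1) : ℝ≥0) with hp
  have hp0 : p 0 = 0 := by simp [hp]
  have hpn : p (n + 1) = t := by simp only [hp]; push_cast; field_simp
  have hstep : ∀ i, (p (i + 1) : ℝ) = p i + t * (1 / (n + 1)) := by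
    intro i; simp only [hp]; push_cast; ring
  have hterm : ∀ᵐ u ∂volume.restrict (Set.Ioi (0 : ℝ)), ∀ i : ℕ,
      ((p i : ℝ) • (truncLp h (p (i + 1)) (hh _) - truncLp h (p i) (hh _)) : L2Pos) u =
        p i * ((Set.Ioc 0 (p (i + 1) : ℝ)).indicator h u - (Set.Ioc 0 (p i : ℝ)).indicator h u) := by
    refine ae_all_iff.2 fun i ↦ ?_
    filter_upwards [Lp.coeFn_smul (p i : ℝ) (truncLp h (p (i + 1)) (hh _) - truncLp h (p i) (hh _)),
      Lp.coeFn_sub (truncLp h (p (i + 1)) (hh _)) (truncLp h (p i) (hh _)),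
      coeFn_truncLp (hh (p (i + 1))), coeFn_truncLp (hh (p i))] with u h1 h2 h3 h4
    rw [h1, Pi.smul_apply, h2, Pi.sub_apply, h3, h4, smul_eq_mul]
  filter_upwards [Lp.coeFn_sub (truncLp (fun u ↦ u * h u) t (hh t).id_mul_Ioc)
      (∑ i ∈ Finset.range (n + 1), (p i : ℝ) •
        (truncLp h (p (i + 1)) (hh _) - truncLp h (p i) (hh _))),
    Lp.coeFn_finsetSum (Finset.range (n + 1)) fun i ↦
      ((p i : ℝ) • (truncLp h (p (i + 1)) (hh _) - truncLp h (p i) (hh _)) : L2Pos),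
    coeFn_truncLp (hh t), coeFn_truncLp (hh t).id_mul_Ioc, hterm] with u h1 h2 h3 h4 h5
  rw [h1, Pi.sub_apply, h2, h3, h4, Finset.sum_apply]
  simp only [h5]
  let χ : ℕ → ℝ := fun i ↦ (Set.Ioc 0 (p i : ℝ)).indicator (fun _ ↦ (1 : ℝ)) u
  have hχ : ∀ i, (Set.Ioc 0 (p i : ℝ)).indicator h u = χ i * h u := by
    intro i; by_cases hu : u ∈ Set.Ioc 0 (p i : ℝ) <;> simp [χ, hu]
  have hχ0 : χ 0 = 0 := by simp [χ, hp0]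
  have htel : ∑ i ∈ Finset.range (n + 1), (χ (i + 1) - χ i) = χ (n + 1) := by
    rw [Finset.sum_range_sub, hχ0, sub_zero]
  -- The difference `χ (i + 1) - χ i` is the indicator of the `i`-th cell, on which `u` exceeds the
  -- left endpoint by at most the mesh.
  have hbd : ∀ i, |(u - p i) * (χ (i + 1) - χ i)| ≤ t * (1 / (n + 1)) * (χ (i + 1) - χ i) := by
    intro i
    have hle : (p i : ℝ) ≤ p (i + 1) := by rw [hstep]; exact le_add_of_nonneg_right (by positivity)
    by_cases h0 : 0 < u
    · by_cases hi : u ≤ p i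
      · simp [χ, h0, hi, hi.trans hle]
      · by_cases hi1 : u ≤ p (i + 1)
        · have := hstep i
          simp only [χ, Set.indicator, Set.mem_Ioc, h0, hi, hi1, true_and, if_true,
            if_false, sub_zero, mul_one]
          rw [abs_of_pos (sub_pos.2 (not_le.1 hi))]
          linarith
        · simp [χ, hi, hi1]
    · simp [χ, h0]
  have hind : (Set.Ioc 0 (t : ℝ)).indicator (fun u ↦ u * h u) u = u * (χ (n + 1) * h u) := by
    rw [← hχ, hpn, Set.indicator_mul_right]
  have hrew : (Set.Ioc 0 (t : ℝ)).indicator (fun u ↦ u * h u) u - ∑ i ∈ Finset.range (n + 1),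
      p i * ((Set.Ioc 0 (p (i + 1) : ℝ)).indicator h u - (Set.Ioc 0 (p i : ℝ)).indicator h u) =
      (∑ i ∈ Finset.range (n + 1), (u - p i) * (χ (i + 1) - χ i)) * h u := by
    rw [hind, ← htel, Finset.sum_mul, Finset.mul_sum, Finset.sum_mul, ← Finset.sum_sub_distrib]
    refine Finset.sum_congr rfl fun i _ ↦ ?_
    rw [hχ, hχ]; ring
  have hlast : ‖(Set.Ioc 0 (t : ℝ)).indicator h u‖ = χ (n + 1) * ‖h u‖ := by
    rw [← hpn, hχ, norm_mul, Real.norm_of_nonneg]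
    exact Set.indicator_nonneg (fun _ _ ↦ zero_le_one) _
  rw [hrew, hlast, norm_mul, ← mul_assoc]
  gcongr
  calc ‖∑ i ∈ Finset.range (n + 1), (u - p i) * (χ (i + 1) - χ i)‖
      ≤ ∑ i ∈ Finset.range (n + 1), t * (1 / (n + 1)) * (χ (i + 1) - χ i) :=
        (norm_sum_le _ _).trans (Finset.sum_le_sum fun i _ ↦ hbd i)
    _ = t * (1 / (n + 1)) * χ (n + 1) := by rw [← Finset.mul_sum, htel]

/-- Integration by parts for the Wiener integral: if `Y_t` is a continuous version of
`J(1_{(0, t]} h)`, then `t Y_t - ∫_0^t Y_u du` is a version of `J(1_{(0, t]} u h(u))`. -/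
theorem map_truncLp_id_mul_ae_eq {Ω : Type*} {mΩ : MeasurableSpace Ω} {P : Measure Ω}
    [IsFiniteMeasure P] (J : L2Pos →ₗᵢ[ℝ] Lp ℝ 2 P) {h : ℝ → ℝ}
    (hh : ∀ t : ℝ≥0, MemLp h 2 (volume.restrict (Set.Ioc 0 (t : ℝ)))) {Y : ℝ≥0 → Ω → ℝ}
    (hYc : ∀ ω, Continuous (Y · ω)) (hY : ∀ t, Y t =ᵐ[P] J (truncLp h t (hh t))) (t : ℝ≥0) :
    J (truncLp (fun u ↦ u * h u) t (hh t).id_mul_Ioc) =ᵐ[P]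
      fun ω ↦ t * Y t ω - ∫ u in (0 : ℝ)..t, Y u.toNNReal ω := by
  have hL2 := (J.continuous.tendsto _).comp (tendsto_sum_smul_truncLp hh t)
  -- The same Riemann–Stieltjes sums converge in `L²(P)` to the left side and pathwise to the right
  -- side; limits in measure are unique.
  refine tendstoInMeasure_ae_unique (tendstoInMeasure_of_tendsto_Lp hL2)
    (tendstoInMeasure_of_tendsto_ae (fun n ↦ (Lp.aestronglyMeasurable _)) ?_)
  let p : ℕ → ℕ → ℝ≥0 := fun n i ↦ (i * t / (n + 1) : ℝ≥0)
  have hall : ∀ᵐ ω ∂P, ∀ n i : ℕ,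
      ((p n i : ℝ) • (J (truncLp h (p n (i + 1)) (hh _)) - J (truncLp h (p n i) (hh _))) :
        Lp ℝ 2 P) ω = p n i * (Y (p n (i + 1)) ω - Y (p n i) ω) := by
    refine ae_all_iff.2 fun n ↦ ae_all_iff.2 fun i ↦ ?_
    filter_upwards [Lp.coeFn_smul (p n i : ℝ)
        (J (truncLp h (p n (i + 1)) (hh _)) - J (truncLp h (p n i) (hh _))),
      Lp.coeFn_sub (J (truncLp h (p n (i + 1)) (hh _))) (J (truncLp h (p n i) (hh _))),
      hY (p n (i + 1)), hY (p n i)] with ω h1 h2 h3 h4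
    rw [h1, Pi.smul_apply, h2, Pi.sub_apply, h3, h4, smul_eq_mul]
  have hsum : ∀ᵐ ω ∂P, ∀ n : ℕ, (∑ i ∈ Finset.range (n + 1),
      ((p n i : ℝ) • (J (truncLp h (p n (i + 1)) (hh _)) - J (truncLp h (p n i) (hh _))) :
        Lp ℝ 2 P)) ω = ∑ i ∈ Finset.range (n + 1),
      ((p n i : ℝ) • (J (truncLp h (p n (i + 1)) (hh _)) - J (truncLp h (p n i) (hh _))) :
        Lp ℝ 2 P) ω := by
    refine ae_all_iff.2 fun n ↦ ?_
    filter_upwards [Lp.coeFn_finsetSum (Finset.range (n + 1)) fun i ↦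
      ((p n i : ℝ) • (J (truncLp h (p n (i + 1)) (hh _)) - J (truncLp h (p n i) (hh _))) :
        Lp ℝ 2 P)] with ω hω
    rw [hω, Finset.sum_apply]
  filter_upwards [hall, hsum] with ω h1 h2
  have hpath := tendsto_sum_mul_sub_of_continuous (y := fun u ↦ Y u.toNNReal ω)
    ((hYc ω).comp continuous_real_toNNReal) t.2
  simp only [NNReal.val_eq_coe, Real.toNNReal_coe] at hpath
  refine hpath.congr fun n ↦ ?_
  simp only [Function.comp_apply, map_sum, map_smul, map_sub]
  refine Eq.trans ?_ (h2 n).symm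
  refine Finset.sum_congr rfl fun i _ ↦ ?_
  have hcast : ∀ j : ℕ, ((j : ℝ) * t / (n + 1)).toNNReal = p n j := fun j ↦ by
    rw [← Real.toNNReal_coe (r := p n j)]
    simp [p]
  rw [h1, hcast, hcast]
  simp [p]

/-! ### Orthogonality of increments, and power functions -/

section TruncationLemmas

lemma truncLp_congr {f g : ℝ → ℝ} {t : ℝ} (hf : MemLp f 2 (volume.restrict (Set.Ioc 0 t)))
    (hg : MemLp g 2 (volume.restrict (Set.Ioc 0 t))) (h : ∀ u ∈ Set.Ioc 0 t, f u = g u) :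
    truncLp f t hf = truncLp g t hg := by
  refine Lp.ext ?_
  filter_upwards [coeFn_truncLp hf, coeFn_truncLp hg] with u h1 h2
  rw [h1, h2, Set.indicator_congr h]

lemma truncLp_const_mul {f : ℝ → ℝ} {t : ℝ} (hf : MemLp f 2 (volume.restrict (Set.Ioc 0 t)))
    (k : ℝ) : truncLp (fun u ↦ k * f u) t (hf.const_mul k) = k • truncLp f t hf := by
  refine Lp.ext ?_
  filter_upwards [coeFn_truncLp hf, coeFn_truncLp (hf.const_mul k),
    Lp.coeFn_smul k (truncLp f t hf)] with u h1 h2 h3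
  rw [h2, h3, Pi.smul_apply, h1, smul_eq_mul, Set.indicator_mul_right]

/-- The difference is `1_{(s, t]}`, whose support misses `(0, r]`. This is the source of the
independence of the increments of `β` from the past. -/
lemma inner_truncLp_one_sub_eq_zero {f : ℝ → ℝ} {r s t : ℝ}
    (hf : MemLp f 2 (volume.restrict (Set.Ioc 0 r))) (hrs : r ≤ s) (hst : s ≤ t) :
    inner ℝ (truncLp (fun _ ↦ 1) t (memLp_one_Ioc t) - truncLp (fun _ ↦ 1) s (memLp_one_Ioc s))
      (truncLp f r hf) = 0 := by
  rw [inner_sub_left, inner_truncLp_truncLp, inner_truncLp_truncLp, min_eq_right hrs,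
    min_eq_right (hrs.trans hst), sub_self]

/-- The square is `u ^ (γ - 1)`, integrable at `0` because `γ > 0`. -/
lemma memLp_rpow_Ioc {γ : ℝ} (hγ : 0 < γ) (t : ℝ) :
    MemLp (fun u : ℝ ↦ u ^ ((γ - 1) / 2)) 2 (volume.restrict (Set.Ioc 0 t)) := by
  rw [memLp_two_iff_integrable_sq (by fun_prop)]
  rcases le_total 0 t with ht | ht
  · have h := (intervalIntegral.intervalIntegrable_rpow' (a := 0) (b := t)
      (r := γ - 1) (by linarith)).1
    refine h.congr ?_
    filter_upwards [ae_restrict_mem measurableSet_Ioc] with u hu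
    rw [← Real.rpow_natCast, ← Real.rpow_mul hu.1.le]
    congr 1
    push_cast
    ring
  · simp [Set.Ioc_eq_empty_of_le ht]

lemma setIntegral_rpow_sq {γ : ℝ} (hγ : 0 < γ) {t : ℝ} (ht : 0 ≤ t) (k : ℝ) :
    ∫ u in Set.Ioc 0 t, (k * u ^ ((γ - 1) / 2)) * (k * u ^ ((γ - 1) / 2)) =
      k ^ 2 / γ * t ^ γ := by
  have : ∫ u in Set.Ioc 0 t, (k * u ^ ((γ - 1) / 2)) * (k * u ^ ((γ - 1) / 2)) =
      ∫ u in Set.Ioc 0 t, k ^ 2 * u ^ (γ - 1) := by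
    refine setIntegral_congr_fun measurableSet_Ioc fun u hu ↦ ?_
    have h1 : u ^ (γ - 1) = u ^ ((γ - 1) / 2) * u ^ ((γ - 1) / 2) := by
      rw [← Real.rpow_add hu.1]; ring_nf
    simp only [h1]
    ring
  rw [this, ← intervalIntegral.integral_of_le ht, intervalIntegral.integral_const_mul,
    integral_rpow (Or.inl (by linarith)), sub_add_cancel, Real.zero_rpow hγ.ne']
  ring

end TruncationLemmas

/-! ### The isonormal process and its Brownian motion -/

section Isonormal

variable {Ω : Type*} {mΩ : MeasurableSpace Ω} {P : Measure Ω}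

lemma covariance_congr_ae {X X' Y Y' : Ω → ℝ} (hX : X =ᵐ[P] X') (hY : Y =ᵐ[P] Y') :
    cov[X, Y; P] = cov[X', Y'; P] := by
  rw [covariance, covariance, integral_congr_ae hX, integral_congr_ae hY]
  refine integral_congr_ae ?_
  filter_upwards [hX, hY] with ω h1 h2
  rw [h1, h2]

/-- A centered Gaussian process whose covariance is that of `∫_0^t h dβ` extends to an isonormal
process on `L²(0, ∞)`. -/
theorem exists_isonormal [IsProbabilityMeasure P] {h : ℝ → ℝ}
    (hh : ∀ t : ℝ≥0, MemLp h 2 (volume.restrict (Set.Ioc 0 (t : ℝ)))) (hne : ∀ u, 0 < u → h u ≠ 0)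
    {Y : ℝ≥0 → Ω → ℝ} (hY : IsGaussianProcess Y P) (hmean : ∀ t, P[Y t] = 0)
    (hcov : ∀ s t : ℝ≥0,
      ∫ ω, Y s ω * Y t ω ∂P = ∫ u in Set.Ioc 0 (min (s : ℝ) t), h u * h u) :
    ∃ J : L2Pos →ₗᵢ[ℝ] Lp ℝ 2 P, (∀ x, HasLaw (J x) (gaussianReal 0 (‖x‖₊ ^ 2)) P) ∧
      ∀ t, Y t =ᵐ[P] J (truncLp h t (hh t)) := by
  have hY2 : ∀ t, MemLp (Y t) 2 P := fun t ↦ (hY.hasGaussianLaw_eval t).memLp_two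
  have hd := denseRange_linearCombination_truncLp hh hne
  obtain ⟨J, hJ⟩ := exists_linearIsometry_of_inner_eq (e := fun t : ℝ≥0 ↦ truncLp h t (hh t))
    (y := fun t ↦ (hY2 t).toLp) (fun s t ↦ by
      rw [inner_truncLp_truncLp, L2.inner_def, ← hcov]
      refine integral_congr_ae ?_
      filter_upwards [(hY2 s).coeFn_toLp, (hY2 t).coeFn_toLp] with ω h1 h2
      rw [h1, h2]
      simp [mul_comm]) hd
  have hJY : ∀ t, Y t =ᵐ[P] J (truncLp h t (hh t)) := fun t ↦ by
    rw [hJ]; exact (hY2 t).coeFn_toLp.symm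
  have hsum : ∀ c : ℝ≥0 →₀ ℝ,
      J (Finsupp.linearCombination ℝ (fun t : ℝ≥0 ↦ truncLp h t (hh t)) c) =ᵐ[P]
        fun ω ↦ ∑ t ∈ c.support, c t • Y t ω := by
    intro c
    rw [Finsupp.linearCombination_apply, Finsupp.sum, map_sum]
    simp only [map_smul]
    have h1 : ∀ᵐ ω ∂P, ∀ t : c.support,
        (c t • J (truncLp h (t : ℝ≥0) (hh t)) : Lp ℝ 2 P) ω = c t • Y t ω := by
      refine ae_all_iff.2 fun t ↦ ?_
      filter_upwards [Lp.coeFn_smul (c t) (J (truncLp h (t : ℝ≥0) (hh t))), hJY t] with ω h1 h2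
      rw [h1, Pi.smul_apply, h2]
    filter_upwards [h1, Lp.coeFn_finsetSum c.support fun t ↦
      (c t • J (truncLp h t (hh t)) : Lp ℝ 2 P)] with ω h1 h2
    rw [h2, Finset.sum_apply]
    exact Finset.sum_congr rfl fun t ht ↦ h1 ⟨t, ht⟩
  refine ⟨J, J.hasLaw_gaussianReal hd (fun c ↦ ?_) fun c ↦ ?_, hJY⟩
  · exact ((hY.smul c).hasGaussianLaw_fun_sum (I := c.support)).congr (hsum c).symm
  · rw [integral_congr_ae (hsum c), integral_finsetSum]
    · simp only [integral_smul, hmean, smul_zero, Finset.sum_const_zero]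
    · exact fun t _ ↦ (hY.hasGaussianLaw_eval t).integrable.smul (c t)

/-- The Brownian motion of an isonormal process on `L²(0, ∞)`. -/
theorem exists_isBrownianReal_of_isonormal [IsProbabilityMeasure P] {J : L2Pos →ₗᵢ[ℝ] Lp ℝ 2 P}
    (hJ : ∀ x, HasLaw (J x) (gaussianReal 0 (‖x‖₊ ^ 2)) P) :
    ∃ β : ℝ≥0 → Ω → ℝ, IsBrownianReal β P ∧ (∀ t, Measurable (β t)) ∧
      ∀ t, β t =ᵐ[P] J (truncLp (fun _ ↦ 1) t (memLp_one_Ioc t)) := by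
  have hB : IsPreBrownianReal
      (fun (t : ℝ≥0) ω ↦ J (truncLp (fun _ ↦ 1) t (memLp_one_Ioc t)) ω) P := by
    refine IsGaussianProcess.isPreBrownianReal_of_covariance
      ((isonormal_isGaussianProcess hJ).comp_right fun t : ℝ≥0 ↦
        truncLp (fun _ ↦ 1) t (memLp_one_Ioc t))
      (fun t ↦ isonormal_integral_eq_zero hJ _) fun s t hst ↦ ?_
    refine (isonormal_covariance_eq_inner hJ _ _).trans ?_
    rw [inner_truncLp_truncLp, min_eq_left (NNReal.coe_le_coe.2 hst)]
    simp
  obtain ⟨β, hm, hc, hβ⟩ := hB.exists_continuous_modification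
    fun t ↦ (Lp.stronglyMeasurable _).measurable
  exact ⟨β, ⟨hB.congr fun t ↦ (hβ t).symm, ae_of_all _ hc⟩, hm, hβ⟩

end Isonormal

/-! ### The joint filtration -/

section Filtration

variable {Ω : Type*} {mΩ : MeasurableSpace Ω}

/-- The natural filtration of the pair of processes `(X, Y)`. -/
def jointFiltration {X Y : ℝ≥0 → Ω → ℝ} (hX : ∀ t, Measurable (X t)) (hY : ∀ t, Measurable (Y t)) :
    Filtration ℝ≥0 mΩ where
  seq s := ⨆ r : Set.Iic s,
    MeasurableSpace.comap (X r) inferInstance ⊔ MeasurableSpace.comap (Y r) inferInstance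
  mono' _ t hst := iSup_le fun r ↦ le_iSup (fun r : Set.Iic t ↦
    MeasurableSpace.comap (X r) inferInstance ⊔ MeasurableSpace.comap (Y r) inferInstance)
    ⟨r, r.2.trans hst⟩
  le' _ := iSup_le fun r ↦ sup_le (hX r).comap_le (hY r).comap_le

variable {X Y : ℝ≥0 → Ω → ℝ} (hX : ∀ t, Measurable (X t)) (hY : ∀ t, Measurable (Y t))

lemma measurable_jointFiltration_left (t : ℝ≥0) : Measurable[jointFiltration hX hY t] (X t) :=
  measurable_iff_comap_le.2 <| le_sup_left.trans <| le_iSup (fun r : Set.Iic t ↦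
    MeasurableSpace.comap (X r) inferInstance ⊔ MeasurableSpace.comap (Y r) inferInstance)
    ⟨t, le_refl t⟩

lemma measurable_jointFiltration_right (t : ℝ≥0) : Measurable[jointFiltration hX hY t] (Y t) :=
  measurable_iff_comap_le.2 <| le_sup_right.trans <| le_iSup (fun r : Set.Iic t ↦
    MeasurableSpace.comap (X r) inferInstance ⊔ MeasurableSpace.comap (Y r) inferInstance)
    ⟨t, le_refl t⟩

/-- The Brownian motion of an isonormal process is a Brownian motion with respect to the joint
filtration of itself and a weighted Wiener integral process. -/
theorem isFiltrationBrownian_jointFiltration {P : Measure Ω} [IsProbabilityMeasure P]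
    {J : L2Pos →ₗᵢ[ℝ] Lp ℝ 2 P} (hJ : ∀ x, HasLaw (J x) (gaussianReal 0 (‖x‖₊ ^ 2)) P)
    {β X : ℝ≥0 → Ω → ℝ} (hB : IsBrownianReal β P) (mβ : ∀ t, Measurable (β t))
    (hβ : ∀ t, β t =ᵐ[P] J (truncLp (fun _ ↦ 1) t (memLp_one_Ioc t)))
    (mX : ∀ t, Measurable (X t)) {h : ℝ → ℝ}
    (hh : ∀ t : ℝ≥0, MemLp h 2 (volume.restrict (Set.Ioc 0 (t : ℝ)))) (c : ℝ≥0 → ℝ)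
    (hX : ∀ t, X t =ᵐ[P] J (c t • truncLp h t (hh t))) :
    IsFiltrationBrownian (jointFiltration mβ mX) β P where
  brownian := hB
  adapted := measurable_jointFiltration_left mβ mX
  indep s t hst := by
    let e : ℝ≥0 → L2Pos := fun t ↦ truncLp (fun _ ↦ 1) t (memLp_one_Ioc t)
    let V : Set.Iic s ⊕ Set.Iic s → L2Pos := Sum.elim (fun r ↦ e r)
      fun r ↦ c r • truncLp h (r : ℝ≥0) (hh r)
    let Z : Set.Iic s ⊕ Set.Iic s → Ω → ℝ := Sum.elim (fun r ↦ β r) fun r ↦ X r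
    have hZV : ∀ i, Z i =ᵐ[P] J (V i) := by
      rintro (r | r)
      · exact hβ r
      · exact hX r
    have hinc : (fun ω ↦ β t ω - β s ω) =ᵐ[P] J (e t - e s) := by
      rw [map_sub]
      filter_upwards [hβ s, hβ t, Lp.coeFn_sub (J (e t)) (J (e s))] with ω h1 h2 h3
      rw [h1, h2, h3]; rfl
    have mZ : ∀ i, Measurable (Z i) := by
      rintro (r | r)
      · exact mβ r
      · exact mX r
    have hind : IndepFun (fun ω (_ : Unit) ↦ β t ω - β s ω) (fun ω i ↦ Z i ω) P := by
      refine IsGaussianProcess.indepFun_of_covariance_eq_zero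
        (X := fun _ : Unit ↦ fun ω ↦ β t ω - β s ω) (Y := Z) ?_
        (fun _ ↦ ((mβ t).sub (mβ s)).aemeasurable) (fun i ↦ (mZ i).aemeasurable) fun _ i ↦ ?_
      · refine ((isonormal_isGaussianProcess hJ).comp_right
          (Sum.elim (fun _ : Unit ↦ e t - e s) V)).congr ?_
        rintro (_ | i)
        · exact hinc.symm
        · exact (hZV i).symm
      · rw [covariance_congr_ae hinc (hZV i), isonormal_covariance_eq_inner hJ]
        rcases i with r | r
        · exact inner_truncLp_one_sub_eq_zero (memLp_one_Ioc _) (NNReal.coe_le_coe.2 r.2) (NNReal.coe_le_coe.2 hst)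
        · refine (real_inner_smul_right _ _ _).trans ?_
          rw [inner_truncLp_one_sub_eq_zero _ (NNReal.coe_le_coe.2 r.2) (NNReal.coe_le_coe.2 hst),
            mul_zero]
    rw [IndepFun_iff_Indep] at hind
    refine indep_of_indep_of_le_left (indep_of_indep_of_le_right hind ?_) ?_
    · refine iSup_le fun r ↦ sup_le ?_ ?_
      · exact measurable_iff_comap_le.1 <|
          (measurable_pi_apply (Sum.inl r)).comp (comap_measurable fun ω i ↦ Z i ω)
      · exact measurable_iff_comap_le.1 <|
          (measurable_pi_apply (Sum.inr r)).comp (comap_measurable fun ω i ↦ Z i ω)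
    · exact measurable_iff_comap_le.1 <| (measurable_pi_apply ()).comp
        (comap_measurable fun ω (_ : Unit) ↦ β t ω - β s ω)

end Filtration

/-! ### Consequences of the power covariance -/

section PowerCovariance

variable {Ω : Type*} {mΩ : MeasurableSpace Ω} {P : Measure Ω} {D γ : ℝ} {ϑ : ℝ≥0 → Ω → ℝ}

lemma covariance_eq_of_integral_mul [IsProbabilityMeasure P] (hgauss : IsGaussianProcess ϑ P)
    (hmean : ∀ t, ∫ ω, ϑ t ω ∂P = 0)
    (hcov : ∀ s t : ℝ≥0, ∫ ω, ϑ s ω * ϑ t ω ∂P =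
      2 * D * (min (s : ℝ) (t : ℝ)) ^ (1 + γ) * max (s : ℝ) (t : ℝ)) (s t : ℝ≥0) :
    cov[ϑ s, ϑ t; P] = 2 * D * (min (s : ℝ) (t : ℝ)) ^ (1 + γ) * max (s : ℝ) (t : ℝ) := by
  rw [covariance_eq_sub (hgauss.hasGaussianLaw_eval s).memLp_two
    (hgauss.hasGaussianLaw_eval t).memLp_two, hmean, zero_mul, sub_zero, ← hcov]
  rfl

/-- For `r ≤ t` the covariance of `ϑ r` and `ϑ t` is linear in `t`, so `t / s` is the regression
coefficient on `ϑ s`, whatever `r ≤ s`. -/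
theorem isMarkovProcess_of_power_covariance [IsProbabilityMeasure P] (hγ : 0 < γ)
    (hmeas : ∀ t, Measurable (ϑ t)) (hgauss : IsGaussianProcess ϑ P)
    (hcov : ∀ s t : ℝ≥0,
      cov[ϑ s, ϑ t; P] = 2 * D * (min (s : ℝ) (t : ℝ)) ^ (1 + γ) * max (s : ℝ) (t : ℝ)) :
    IsMarkovProcess ϑ P := by
  have h2 : ∀ t, MemLp (ϑ t) 2 P := fun t ↦ (hgauss.hasGaussianLaw_eval t).memLp_two
  refine hgauss.isMarkovProcess hmeas fun s t hst ↦ ⟨t / s, fun r hr ↦ ?_⟩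
  rw [covariance_fun_sub_left (h2 t) ((h2 s).const_mul _) (h2 r), covariance_const_mul_left,
    hcov, hcov]
  have hst' : (s : ℝ) ≤ t := hst
  have hr' : (r : ℝ) ≤ s := hr
  rw [min_eq_right (hr'.trans hst'), min_eq_right hr', max_eq_left (hr'.trans hst'),
    max_eq_left hr']
  -- For `s = 0` the quotient `t / s` is `0` by convention, but then `r = 0` and both covariances
  -- vanish.
  rcases eq_or_ne (s : ℝ) 0 with hs | hs
  · have hr0 : (r : ℝ) = 0 := le_antisymm (hs ▸ hr') r.2
    rw [hr0, Real.zero_rpow (by positivity)]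
    ring
  · field_simp
    ring

/-- The covariance is homogeneous of degree `2 + γ`, twice the index, and a centered Gaussian law is
determined by its covariance. -/
theorem isSelfSimilar_of_power_covariance (hmeas : ∀ t, Measurable (ϑ t)) (hgauss : IsGaussianProcess ϑ P)
    (hmean : ∀ t, ∫ ω, ϑ t ω ∂P = 0)
    (hcov : ∀ s t : ℝ≥0,
      cov[ϑ s, ϑ t; P] = 2 * D * (min (s : ℝ) (t : ℝ)) ^ (1 + γ) * max (s : ℝ) (t : ℝ)) :
    IsSelfSimilar ϑ ((2 + γ) / 2) P := by
  intro a ha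
  have ha' : (0 : ℝ) < a := ha
  refine IsGaussianProcess.identDistrib_of_covariance_eq (X := fun t ω ↦ ϑ (a * t) ω)
    (Y := fun t ω ↦ (a : ℝ) ^ ((2 + γ) / 2) * ϑ t ω) (hgauss.comp_right (a * ·))
    (hgauss.smul fun _ ↦ (a : ℝ) ^ ((2 + γ) / 2)) (fun t ↦ hmeas _)
    (fun t ↦ (hmeas t).const_mul _) (fun t ↦ ?_) fun s t ↦ ?_
  · rw [integral_const_mul, hmean, hmean, mul_zero]
  · rw [covariance_const_mul_left, covariance_const_mul_right, hcov, hcov]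
    rw [NNReal.coe_mul, NNReal.coe_mul, ← mul_min_of_nonneg _ _ ha'.le,
      ← mul_max_of_nonneg _ _ ha'.le, Real.mul_rpow ha'.le (le_min s.coe_nonneg t.coe_nonneg)]
    have h1 : (a : ℝ) ^ ((2 + γ) / 2) * (a : ℝ) ^ ((2 + γ) / 2) = (a : ℝ) ^ (1 + γ) * a := by
      rw [← Real.rpow_add ha', ← Real.rpow_add_one ha'.ne']
      ring_nf
    linear_combination -(2 * D * (min (s : ℝ) t) ^ (1 + γ) * max (s : ℝ) t) * h1

/-- The process `ϑ t / t` has a continuous modification, as it is a time change of a Brownian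
motion. -/
theorem exists_continuous_div_of_power_covariance (hD : 0 < D) (hγ : 0 < γ)
    (hmeas : ∀ t, Measurable (ϑ t)) (hgauss : IsGaussianProcess ϑ P)
    (hmean : ∀ t, ∫ ω, ϑ t ω ∂P = 0)
    (hcov : ∀ s t : ℝ≥0,
      cov[ϑ s, ϑ t; P] = 2 * D * (min (s : ℝ) (t : ℝ)) ^ (1 + γ) * max (s : ℝ) (t : ℝ)) :
    ∃ Y : ℝ≥0 → Ω → ℝ, (∀ t, Measurable (Y t)) ∧ (∀ ω, Continuous (Y · ω)) ∧
      ∀ t : ℝ≥0, Y t =ᵐ[P] fun ω ↦ (t : ℝ)⁻¹ * ϑ t ω := by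
  -- The clock of `ϑ t / t` is `2D t ^ γ`; substituting `t = v ^ (1 / γ)` and dividing by `√(2D)`
  -- leaves the covariance `u ∧ v`.
  let W : ℝ≥0 → Ω → ℝ := fun v ω ↦ (√(2 * D) * (v ^ (1 / γ) : ℝ≥0))⁻¹ * ϑ (v ^ (1 / γ)) ω
  have hsq : √(2 * D) * √(2 * D) = 2 * D := Real.mul_self_sqrt (by positivity)
  have hsq0 : √(2 * D) ≠ 0 := by positivity
  have hinv : ∀ v : ℝ≥0, (v ^ (1 / γ)) ^ γ = v := fun v ↦ by
    rw [← NNReal.rpow_mul, one_div_mul_cancel hγ.ne', NNReal.rpow_one]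
  have hW : IsPreBrownianReal W P := by
    refine IsGaussianProcess.isPreBrownianReal_of_covariance
      ((hgauss.comp_right fun v : ℝ≥0 ↦ v ^ (1 / γ)).smul
        fun v ↦ (√(2 * D) * (v ^ (1 / γ) : ℝ≥0))⁻¹) (fun v ↦ ?_) fun u v huv ↦ ?_
    · rw [integral_const_mul, hmean, mul_zero]
    · rw [covariance_const_mul_left, covariance_const_mul_right]
      have hle : u ^ (1 / γ) ≤ v ^ (1 / γ) := NNReal.rpow_le_rpow huv (by positivity)
      have hu : (u : ℝ) = ((u ^ (1 / γ) : ℝ≥0) : ℝ) ^ γ := by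
        rw [← NNReal.coe_rpow, hinv]
      change _ * (_ * cov[ϑ (u ^ (1 / γ)), ϑ (v ^ (1 / γ)); P]) = _
      rw [hcov, hu, min_eq_left (NNReal.coe_le_coe.2 hle), max_eq_right (NNReal.coe_le_coe.2 hle)]
      set a := u ^ (1 / γ)
      set b := v ^ (1 / γ)
      rcases eq_or_ne a 0 with ha | ha
      · simp [ha, hγ.ne']
      · have ha0 : (0 : ℝ) < a := NNReal.coe_pos.2 (pos_of_ne_zero ha)
        have hb0 : (0 : ℝ) < b := ha0.trans_le (NNReal.coe_le_coe.2 hle)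
        rw [Real.rpow_add ha0, Real.rpow_one]
        field_simp
        rw [sq, hsq]
  obtain ⟨C, mC, hC, hCW⟩ := hW.exists_continuous_modification fun v ↦ (hmeas _).const_mul _
  refine ⟨fun t ω ↦ √(2 * D) * C (t ^ γ) ω, fun t ↦ (mC _).const_mul _, fun ω ↦ ?_, fun t ↦ ?_⟩
  · exact continuous_const.mul ((hC ω).comp (NNReal.continuous_rpow_const hγ.le))
  · filter_upwards [hCW (t ^ γ)] with ω hω
    have ht : (t ^ γ) ^ (1 / γ) = t := by
      rw [← NNReal.rpow_mul, mul_one_div_cancel hγ.ne', NNReal.rpow_one]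
    simp only [hω, W, ht]
    rw [mul_inv, ← mul_assoc, ← mul_assoc, mul_inv_cancel₀ hsq0, one_mul]

end PowerCovariance

/-! ### Assembly of the theorem -/

theorem proposition2p23 {Ω : Type*} {mΩ : MeasurableSpace Ω} (P : Measure Ω)
    [IsProbabilityMeasure P] (D γ : ℝ) (hD : 0 < D) (hγ : 0 < γ)
    (ϑ : ℝ≥0 → Ω → ℝ) (hmeas : ∀ t, Measurable (ϑ t))
    (hgauss : IsGaussianProcess ϑ P)
    (hmean : ∀ t, ∫ ω, ϑ t ω ∂P = 0)
    (hcov : ∀ s t : ℝ≥0, ∫ ω, ϑ s ω * ϑ t ω ∂P =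
      2 * D * (min (s : ℝ) (t : ℝ)) ^ (1 + γ) * max (s : ℝ) (t : ℝ)) :
    -- (i) Markov property
    IsMarkovProcess ϑ P ∧
    -- (ii) self-similarity
    IsSelfSimilar ϑ ((2 + γ) / 2) P ∧
    ∃ (𝓕 : Filtration ℝ≥0 mΩ) (β : ℝ≥0 → Ω → ℝ),
      IsFiltrationBrownian 𝓕 β P ∧
      -- (iii) representation as a Wiener integral
      (∀ t : ℝ≥0, ∃ I : Ω → ℝ,
        IsWienerIntegral β P (fun u => u ^ ((γ - 1) / 2)) t I ∧
        ∀ᵐ ω ∂P, ϑ t ω = √(2 * D * γ) * t * I ω) ∧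
      -- (iv) the stochastic differential equation, for a continuous modification
      (∃ X : ℝ≥0 → Ω → ℝ, (∀ t, X t =ᵐ[P] ϑ t) ∧
        IsSDESolution 𝓕 β P (fun t x => 1 / t * x)
          (fun t => √(2 * D * γ) * t ^ ((γ + 1) / 2)) X) := by
  have hcov' := covariance_eq_of_integral_mul hgauss hmean hcov
  refine ⟨isMarkovProcess_of_power_covariance hγ hmeas hgauss hcov',
    isSelfSimilar_of_power_covariance hmeas hgauss hmean hcov', ?_⟩
  obtain ⟨Y, mY, hYc, hY⟩ :=
    exists_continuous_div_of_power_covariance hD hγ hmeas hgauss hmean hcov'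
  set k : ℝ := √(2 * D * γ) with hk
  have hk0 : k ≠ 0 := by positivity
  have hk2 : k ^ 2 = 2 * D * γ := Real.sq_sqrt (by positivity)
  let h : ℝ → ℝ := fun u ↦ k * u ^ ((γ - 1) / 2)
  have hh : ∀ t : ℝ≥0, MemLp h 2 (volume.restrict (Set.Ioc 0 (t : ℝ))) := fun t ↦
    (memLp_rpow_Ioc hγ t).const_mul k
  have hYg : IsGaussianProcess Y P :=
    (hgauss.smul fun t : ℝ≥0 ↦ (t : ℝ)⁻¹).congr fun t ↦ (hY t).symm
  have hYmean : ∀ t, P[Y t] = 0 := fun t ↦ by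
    rw [integral_congr_ae (hY t), integral_const_mul, hmean, mul_zero]
  have hYcov : ∀ s t : ℝ≥0,
      ∫ ω, Y s ω * Y t ω ∂P = ∫ u in Set.Ioc 0 (min (s : ℝ) t), h u * h u := by
    intro s t
    have h1 : ∫ ω, Y s ω * Y t ω ∂P = ∫ ω, ((s : ℝ)⁻¹ * (t : ℝ)⁻¹) * (ϑ s ω * ϑ t ω) ∂P := by
      refine integral_congr_ae ?_
      filter_upwards [hY s, hY t] with ω h1 h2
      rw [h1, h2]
      ring
    have h2 : ∫ u in Set.Ioc 0 (min (s : ℝ) t), h u * h u = k ^ 2 / γ * (min (s : ℝ) t) ^ γ :=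
      setIntegral_rpow_sq hγ (le_min s.coe_nonneg t.coe_nonneg) k
    rw [h2, hk2, h1, integral_const_mul, hcov,
      mul_div_cancel_right₀ _ hγ.ne', ← mul_inv, ← min_mul_max (s : ℝ) t]
    have hm0 : 0 ≤ min (s : ℝ) t := le_min s.coe_nonneg t.coe_nonneg
    rcases hm0.eq_or_lt with hm | hm
    · rw [← hm, Real.zero_rpow (by positivity), Real.zero_rpow hγ.ne']
      simp
    · have hM : 0 < max (s : ℝ) t := hm.trans_le min_le_max
      rw [Real.rpow_add hm, Real.rpow_one]
      field_simp
  obtain ⟨J, hJ, hJY⟩ := exists_isonormal hh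
    (fun u hu ↦ mul_ne_zero hk0 (Real.rpow_pos_of_pos hu _).ne') hYg hYmean hYcov
  obtain ⟨β, hB, mβ, hβ⟩ := exists_isBrownianReal_of_isonormal hJ
  let X : ℝ≥0 → Ω → ℝ := fun t ω ↦ t * Y t ω
  have mX : ∀ t, Measurable (X t) := fun t ↦ (mY t).const_mul _
  have hX : ∀ t, X t =ᵐ[P] ϑ t := by
    intro t
    -- At `t = 0` the quotient carries no information, but `ϑ 0` has zero second moment and so
    -- vanishes almost surely, as `X 0` does.
    rcases eq_or_ne t 0 with rfl | ht
    · have h2 : MemLp (ϑ 0) 2 P := (hgauss.hasGaussianLaw_eval 0).memLp_two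
      have h0 : ∫ ω, ϑ 0 ω ^ 2 ∂P = 0 := by
        simp_rw [sq, hcov]
        simp
      rw [integral_eq_zero_iff_of_nonneg (fun _ ↦ sq_nonneg _) h2.integrable_sq] at h0
      filter_upwards [h0] with ω hω
      simp only [Pi.zero_apply, sq_eq_zero_iff] at hω
      simp [X, hω]
    · have ht' : (t : ℝ) ≠ 0 := NNReal.coe_ne_zero.2 ht
      filter_upwards [hY t] with ω hω
      simp only [X, hω]
      rw [← mul_assoc, mul_inv_cancel₀ ht', one_mul]
  have hFB : IsFiltrationBrownian (jointFiltration mβ mX) β P := by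
    refine isFiltrationBrownian_jointFiltration hJ hB mβ hβ mX hh (fun t ↦ t) fun t ↦ ?_
    rw [map_smul]
    filter_upwards [hJY t, Lp.coeFn_smul (t : ℝ) (J (truncLp h t (hh t)))] with ω h1 h2
    rw [h2, Pi.smul_apply, ← h1, smul_eq_mul]
  refine ⟨jointFiltration mβ mX, β, hFB, fun t ↦ ?_, X, hX, ?_⟩
  · refine ⟨J (truncLp _ t (memLp_rpow_Ioc hγ t)),
      isWienerIntegral_truncLp J hβ (memLp_rpow_Ioc hγ t), ?_⟩
    have hJt : J (truncLp h t (hh t)) = k • J (truncLp _ t (memLp_rpow_Ioc hγ t)) := by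
      rw [← map_smul, ← truncLp_const_mul]
    filter_upwards [hX t, hJY t, Lp.coeFn_smul k (J (truncLp _ t (memLp_rpow_Ioc hγ t)))]
      with ω h1 h2 h3
    rw [hJt, h3, Pi.smul_apply, smul_eq_mul] at h2
    rw [← h1]
    simp only [X, h2]
    ring
  · have hYc' : ∀ ω, Continuous fun u : ℝ ↦ Y u.toNNReal ω := fun ω ↦
      (hYc ω).comp continuous_real_toNNReal
    have hdrift : ∀ ω, ∀ u : ℝ, 0 < u → 1 / u * X u.toNNReal ω = Y u.toNNReal ω := by
      intro ω u hu
      simp only [X, Real.coe_toNNReal u hu.le]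
      field_simp
    have hdrift_int : ∀ ω (t : ℝ≥0), ∫ u in (0 : ℝ)..t, 1 / u * X u.toNNReal ω =
        ∫ u in (0 : ℝ)..t, Y u.toNNReal ω := by
      intro ω t
      rw [intervalIntegral.integral_of_le t.coe_nonneg, intervalIntegral.integral_of_le t.coe_nonneg]
      exact setIntegral_congr_fun measurableSet_Ioc fun u hu ↦ hdrift ω u hu.1
    have hσ : ∀ t : ℝ, ∀ u ∈ Set.Ioc 0 t, u * h u = k * u ^ ((γ + 1) / 2) := by
      intro t u hu
      have : u ^ ((γ + 1) / 2) = u ^ ((γ - 1) / 2) * u := by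
        rw [← Real.rpow_add_one hu.1.ne']; ring_nf
      simp only [h, this]
      ring
    have hσLp : ∀ t : ℝ≥0,
        MemLp (fun u : ℝ ↦ k * u ^ ((γ + 1) / 2)) 2 (volume.restrict (Set.Ioc 0 (t : ℝ))) := by
      intro t
      refine (hh t).id_mul_Ioc.ae_eq ?_
      filter_upwards [ae_restrict_mem measurableSet_Ioc] with u hu using hσ t u hu
    refine ⟨hFB, measurable_jointFiltration_right mβ mX, ae_of_all _ fun ω ↦ ?_,
      ae_of_all _ fun ω t ↦ ?_,
      fun t ω ↦ t * Y t ω - ∫ u in (0 : ℝ)..t, Y u.toNNReal ω, fun t ↦ ?_,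
      ae_of_all _ fun ω t ↦ ?_⟩
    · exact NNReal.continuous_coe.mul (hYc ω)
    · refine ((hYc' ω).intervalIntegrable 0 t).congr fun u hu ↦ ?_
      rw [Set.uIoc_of_le t.coe_nonneg] at hu
      exact (hdrift ω u hu.1).symm
    · refine (isWienerIntegral_truncLp J hβ (hσLp t)).congr ?_
      rw [← truncLp_congr (hh t).id_mul_Ioc (hσLp t) (hσ t)]
      exact map_truncLp_id_mul_ae_eq J hh hYc hJY t
    -- Since `X 0 = 0` and the drift integrates to `∫ Y`, the equation is now an algebraic identity
    -- for every path.
    · rw [hdrift_int]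
      simp [X]
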